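/- **Setting.** Let $d \ge 1$ and let $\mathcal X \subset \{0,1\}^d$ be a set of decisions with $m := \max_{x\in\mathcal X} \mathbf 1^\top x \ge 2$. Let $Z(1), Z(2), \dots$ be i.i.d. random vectors in $[0,1]^d$ with mean $\theta$ and independent entries. At each time $t \ge 1$ a policy selects a decision $x(t) \in \mathcal X$ as a (measurable) function of the past feedback $Y(1),\dots,Y(t-1)$, where $Y(s) = (x_i(s) Z_i(s))_{i=1,\dots,d}$. Put $\Delta_x = \max_{y \in \mathcal X}\theta^\top y - \theta^\top x$, assume that $\Delta_x > 0$ for some $x \in \mathcal X$, put $\Delta_{\min} = \min_{x \in \mathcal X:\Delta_x > 0} \Delta_x$, and let the regret be $R(T) = \sum_{t=1}^T \mathbb E(\Delta_{x(t)})$. Let $f(t) = \ln t + 4m \ln\ln t$, where for $t \in \{1,2\}$ the term $\ln \ln t$ is replaced by $0$. For $i = 1,\dots,d$ let $n_i(t) = \sum_{s=1}^{t-1} x_i(s)$, $\hat\theta_i(t) = \frac{\sum_{s=1}^{t-1} x_i(s) Z_i(s)}{\max(1,n_i(t))}$, and $\sigma_i^2(t) = \frac{f(t)}{2 n_i(t)}$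 if $n_i(t) \ge 1$, $\sigma_i^2(t) = +\infty$ otherwise (with $0\cdot\infty = 0$). Given real sequences $(\varepsilon_t)_{t\ge1}$ with $\varepsilon_t > 0$ and $(\delta_t)_{t\ge1}$, AESCB with parameters $(\varepsilon_t,\delta_t)$ is any policy such that for all $t \ge 1$ $$\max_{x \in \mathcal X}\Big\{\hat\theta(t)^\top x + \sqrt{\sigma^2(t)^\top x}\Big\} \le \delta_t + \hat\theta(t)^\top x(t) + \frac{1}{\varepsilon_t}\sqrt{\sigma^2(t)^\top x(t)} .$$ **Theorem (Regret of AESCB).** There are positive numbers $C_4(m)$, each depending on $m$ only, such that the following holds for AESCB with parameters $(\varepsilon_t,\delta_t)$ in every such setting. 1. For all $T \ge 1$, $$R(T) \le C_4(m) + \frac{2 d m^3}{\Delta_{\min}^2} + \frac{24\, d\, f(T)}{(\min_{1 \le t\le T}\varepsilon_t)^2\,\Delta_{\min}} \left\lceil \frac{\ln m}{1.61}\right\rceil^2 + 4\sum_{t=1}^T \delta_t\, \mathbf 1(\Delta_{\min} \le 4\delta_t).$$ 2. If $\varepsilon_t = \varepsilon$ for all $t$ and $\lim_{t\to\infty}\delta_t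 = 0$, then $$R(T) = \mathcal O\Big(d (\ln m)^2 \frac{1}{\Delta_{\min}} \ln T\Big) \quad \text{as } T \to \infty,$$ where the implied constant depends on $\varepsilon$ only (that is, there is $K = K(\varepsilon) > 0$ such that in every such setting the bound $R(T) \le K\, d(\ln m)^2 \Delta_{\min}^{-1}\ln T$ holds for all sufficiently large $T$). 3. If $\varepsilon_t = \varepsilon$ and $\delta_t < \frac14 \Delta_{\min}$ for all $t$, then for all $T \ge 1$, with the same $C_4(m)$, $$R(T) \le C_4(m) + \frac{2 d m^3}{\Delta_{\min}^2} + \frac{24\, d\, f(T)}{\varepsilon^2 \Delta_{\min}}\left\lceil \frac{\ln m}{1.61}\right\rceil^2 .$$ -/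

import Mathlib

open Filter Topology MeasureTheory ProbabilityTheory

noncomputable section

namespace SemiBandit

/-! Combinatorial semi-bandits.  A decision `x ∈ {0,1}^d` is identified with its support, a
`Finset (Fin d)`; the combinatorial set of decisions is a finite family `X` of such supports.
Rounds are numbered `t = 1, 2, …`; values at `t = 0` are never used. -/

variable {d : ℕ} {Ω : Type*}

/-- `m = max_{x ∈ X} 1ᵀx`, the size of the largest decision. -/
def maxSize (X : Finset (Finset (Fin d))) : ℕ := X.sup Finset.card

/-- The linear form `θᵀx`. -/
def reward (θ : Fin d → ℝ) (A : Finset (Fin d)) : ℝ := ∑ i ∈ A, θ i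

/-- The optimal expected reward `θᵀx⋆ = max_{x ∈ X} θᵀx`
(a maximum, because `X` is finite and, wherever this is used, nonempty). -/
def optReward (X : Finset (Finset (Fin d))) (θ : Fin d → ℝ) : ℝ :=
  sSup (reward θ '' (X : Set (Finset (Fin d))))

/-- The reward gap `Δ_x = θᵀ(x⋆ - x)`. -/
def gap (X : Finset (Finset (Fin d))) (θ : Fin d → ℝ) (A : Finset (Fin d)) : ℝ :=
  optReward X θ - reward θ A

/-- The smallest non-null gap `Δ_min = min_{x ∈ X : Δ_x > 0} Δ_x`
(a minimum as soon as some decision of `X` has a positive gap). -/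
def minGap (X : Finset (Finset (Fin d))) (θ : Fin d → ℝ) : ℝ :=
  sInf {g : ℝ | ∃ A ∈ X, gap X θ A = g ∧ 0 < g}

/-- The stochastic environment: `Z(1), Z(2), …` are i.i.d. random vectors with values in `[0,1]^d`,
with independent entries and mean `θ`.  Independence of the rounds together with independence of
the entries within a round is joint independence of all the `Z_i(t)`, `t ≥ 1`. -/
structure IsEnvironment [MeasurableSpace Ω] (μ : Measure Ω) (θ : Fin d → ℝ)
    (Z : ℕ → Fin d → Ω → ℝ) : Prop where
  measurable : ∀ t, 1 ≤ t → ∀ i, Measurable (Z t i)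
  mem_Icc : ∀ t, 1 ≤ t → ∀ i ω, Z t i ω ∈ Set.Icc (0 : ℝ) 1
  indep : iIndepFun (fun p : ℕ × Fin d => Z (p.1 + 1) p.2) μ
  identDistrib : ∀ t, 1 ≤ t → ∀ i, IdentDistrib (Z t i) (Z 1 i) μ μ
  mean : ∀ i, ∫ ω, Z 1 i ω ∂μ = θ i

/-- The semi-bandit feedback `Y_i(t) = x_i(t) Z_i(t)`. -/
def feedback (Z : ℕ → Fin d → Ω → ℝ) (x : ℕ → Ω → Finset (Fin d)) (t : ℕ) (i : Fin d) (ω : Ω) :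
    ℝ :=
  if i ∈ x t ω then Z t i ω else 0

/-- The σ-algebra generated by the feedback `Y(1), …, Y(t-1)` available at time `t`. -/
abbrev history (Z : ℕ → Fin d → Ω → ℝ) (x : ℕ → Ω → Finset (Fin d)) (t : ℕ) : MeasurableSpace Ω :=
  ⨆ s ∈ Finset.Ico 1 t, ⨆ i : Fin d, MeasurableSpace.comap (feedback Z x s i) inferInstance

/-- `x` is the sequence of decisions of a policy: `x(t) ∈ X` is a (measurable) function of
`Y(1), …, Y(t-1)`. -/
structure IsPolicy (X : Finset (Finset (Fin d))) (Z : ℕ → Fin d → Ω → ℝ)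
    (x : ℕ → Ω → Finset (Fin d)) : Prop where
  mem : ∀ t, 1 ≤ t → ∀ ω, x t ω ∈ X
  adapted : ∀ t, 1 ≤ t → ∀ A : Finset (Fin d), MeasurableSet[history Z x t] {ω | x t ω = A}

/-- The regret `R(T) = ∑_{t=1}^T 𝔼(Δ_{x(t)})`. -/
def regret [MeasurableSpace Ω] (μ : Measure Ω) (X : Finset (Finset (Fin d))) (θ : Fin d → ℝ)
    (x : ℕ → Ω → Finset (Fin d)) (T : ℕ) : ℝ :=
  ∑ t ∈ Finset.Icc 1 T, ∫ ω, gap X θ (x t ω) ∂μ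

/-- `f(t) = ln t + 4 m ln ln t`, where `ln ln t` is replaced by `0` for `t ≤ 2`
(it is positive for `t ≥ 3`, and `-∞` or negative for `t = 1, 2`). -/
def explore (m t : ℕ) : ℝ := Real.log t + 4 * m * max (Real.log (Real.log t)) 0

/-- `n_i(t) = ∑_{s=1}^{t-1} x_i(s)`. -/
def count (x : ℕ → Ω → Finset (Fin d)) (t : ℕ) (i : Fin d) (ω : Ω) : ℕ :=
  ∑ s ∈ Finset.Ico 1 t, if i ∈ x s ω then 1 else 0

/-- The empirical mean `(∑_{s=1}^{t-1} x_i(s) Z_i(s)) / max(1, n_i(t))`. -/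
def empMean (Z : ℕ → Fin d → Ω → ℝ) (x : ℕ → Ω → Finset (Fin d)) (t : ℕ) (i : Fin d) (ω : Ω) : ℝ :=
  (∑ s ∈ Finset.Ico 1 t, feedback Z x s i ω) / max 1 (count x t i ω : ℝ)

/-- `σ_i²(t) = f(t) / (2 n_i(t))` if `n_i(t) ≥ 1`, and `+∞` otherwise. -/
def sigmaSq (m : ℕ) (x : ℕ → Ω → Finset (Fin d)) (t : ℕ) (i : Fin d) (ω : Ω) : ENNReal :=
  if 1 ≤ count x t i ω then ENNReal.ofReal (explore m t / (2 * count x t i ω)) else ⊤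

/-- `θ̂(t)ᵀA + κ √(σ²(t)ᵀA)`, with values in the extended reals.  The linear forms are sums over the
support of `A`, so that an infinite `σ_i²(t)` counts only for `i ∈ A`. -/
def index (m : ℕ) (Z : ℕ → Fin d → Ω → ℝ) (x : ℕ → Ω → Finset (Fin d)) (κ : ℝ) (t : ℕ) (ω : Ω)
    (A : Finset (Fin d)) : EReal :=
  ((∑ i ∈ A, empMean Z x t i ω : ℝ) : EReal) +
    ((ENNReal.ofReal κ * (∑ i ∈ A, sigmaSq m x t i ω) ^ (1 / 2 : ℝ) : ENNReal) : EReal)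

/-- `x` is a sequence of decisions of AESCB with approximation factors `(ε_t, δ_t)`: a policy with
`max_{B ∈ X} {θ̂(t)ᵀB + √(σ²(t)ᵀB)} ≤ δ_t + θ̂(t)ᵀx(t) + (1/ε_t) √(σ²(t)ᵀx(t))` for all `t ≥ 1`.
Ties are broken arbitrarily: nothing else is required of `x`. -/
structure IsAESCB (X : Finset (Finset (Fin d))) (Z : ℕ → Fin d → Ω → ℝ) (ε δ : ℕ → ℝ)
    (x : ℕ → Ω → Finset (Fin d)) : Prop where
  policy : IsPolicy X Z x
  near_opt : ∀ t, 1 ≤ t → ∀ ω,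
    X.sup (fun B => index (maxSize X) Z x 1 t ω B) ≤
      (δ t : EReal) + index (maxSize X) Z x (1 / ε t) t ω (x t ω)

/-- `C + 2 d m³ / Δ² + (24 d f(T) / (e² Δ)) ⌈ln m / 1.61⌉²`. -/
def mainBound (C : ℝ) (d m T : ℕ) (Δ e : ℝ) : ℝ :=
  C + 2 * d * m ^ 3 / Δ ^ 2 +
    24 * d * explore m T / (e ^ 2 * Δ) * (⌈Real.log m / 1.61⌉ : ℝ) ^ 2

end SemiBandit

end

/-!
The regret of a round is charged, pointwise on the sample space, to one of five causes, and each
charge is summed over the rounds.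

* *Optimism fails*: the index of an optimal decision lies below its true reward. By the
  Cauchy-Schwarz inequality the Chernoff exponents of its entries then add up to more than `f(t)`
  (`one_le_failWeight`). A union bound over a grid of `O(ln² t)` exponential parameters for each
  of the at most `m` entries, together with the exponential supermartingale of the policy
  (`lintegral_prod_expDev_le_one`), bounds the probability by a constant times `1 / (t ln² t)`,
  which is summable. This gives the constant `C₄(m)`.
* *The additive slack `δ_t` is at least a quarter of the gap*: this is the last sum of the bound.
* *An entry played has never been observed*: this happens at most once for each entry.
* *An entry played is overestimated* by a fixed fraction of the gap divided by `m`. Optional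
  skipping (`lintegral_level_add_le_one`, `integral_sum_level_le`) reduces the sum over the rounds
  to a sum over the number `n` of observations of that entry.
* *The exploration bonus is large*: then `Δ² ≤ a ∑ 1 / n_i` over the entries of the decision, and
  the gap is shared among its entries (`le_sum_share`) in such a way that the shares of one entry
  add up to `O(a ln m / Δ_min)` (`sum_share_le`).

Let `e` be the smallest `ε_t`. There are two regimes. If `e < 2`, then once `ln T` exceeds a
suitable function of `m` (earlier rounds are paid by `C₄(m)`), the exploration term of the bound
dominates everything of order `d m² / Δ_min`. The threshold for overestimation may then be a
quarter of the actual gap of the round, and unobserved entries and overestimation fit into the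
difference between `24 ⌈ln m / 1.61⌉²` and `16 ln (1 + √m)` (`regret_le_of_lt_two`). If `e ≥ 2`,
the exploration term may be negligible. But the decision played is itself a competitor in the
condition defining the policy, so that its exploration bonus is at most `2 δ_t`: a round not paid
by the slack involves an overestimated entry, and, once `t` exceeds a function of `m`, this entry
has been observed at least three times. The geometric series without its first terms leaves room
in `2 d m³ / Δ_min²` for the unobserved entries (`one_add_sum_exp_le`, `regret_le_of_two_le`).
-/

noncomputable section

namespace SemiBandit

/-! ### The filtration of the environment -/

variable {d : ℕ} {Ω : Type*}

/-- The σ-algebra generated by the full vectors `Z(1), …, Z(t-1)`. -/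
abbrev past (Z : ℕ → Fin d → Ω → ℝ) (t : ℕ) : MeasurableSpace Ω :=
  ⨆ p ∈ {p : ℕ × Fin d | p.1 + 1 < t}, MeasurableSpace.comap (Z (p.1 + 1) p.2) inferInstance

/-- The σ-algebra generated by the vector `Z(t)`. -/
abbrev present (Z : ℕ → Fin d → Ω → ℝ) (t : ℕ) : MeasurableSpace Ω :=
  ⨆ p ∈ {p : ℕ × Fin d | p.1 + 1 = t}, MeasurableSpace.comap (Z (p.1 + 1) p.2) inferInstance

lemma past_mono (Z : ℕ → Fin d → Ω → ℝ) {s t : ℕ} (h : s ≤ t) : past Z s ≤ past Z t :=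
  biSup_mono fun _ hp => lt_of_lt_of_le hp h

lemma measurable_past (Z : ℕ → Fin d → Ω → ℝ) {s t : ℕ} (hs : 1 ≤ s) (h : s < t) (i : Fin d) :
    Measurable[past Z t] (Z s i) := by
  obtain ⟨s, rfl⟩ : ∃ r, s = r + 1 := ⟨s - 1, by omega⟩
  refine Measurable.mono (comap_measurable _) ?_ le_rfl
  exact le_biSup (fun p : ℕ × Fin d => MeasurableSpace.comap (Z (p.1 + 1) p.2) inferInstance)
    (show ((s, i) : ℕ × Fin d) ∈ {p : ℕ × Fin d | p.1 + 1 < t} from h)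

lemma measurable_present (Z : ℕ → Fin d → Ω → ℝ) {t : ℕ} (ht : 1 ≤ t) (i : Fin d) :
    Measurable[present Z t] (Z t i) := by
  obtain ⟨s, rfl⟩ : ∃ r, t = r + 1 := ⟨t - 1, by omega⟩
  refine Measurable.mono (comap_measurable _) ?_ le_rfl
  exact le_biSup (fun p : ℕ × Fin d => MeasurableSpace.comap (Z (p.1 + 1) p.2) inferInstance)
    (show ((s, i) : ℕ × Fin d) ∈ {p : ℕ × Fin d | p.1 + 1 = s + 1} from rfl)

lemma measurableSet_mem_of_eq {m : MeasurableSpace Ω} {y : Ω → Finset (Fin d)}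
    (h : ∀ A, MeasurableSet[m] {ω | y ω = A}) (i : Fin d) : MeasurableSet[m] {ω | i ∈ y ω} := by
  have : {ω | i ∈ y ω} = ⋃ A ∈ {A : Finset (Fin d) | i ∈ A}, {ω | y ω = A} := by
    ext ω; simp
  rw [this]
  exact MeasurableSet.biUnion (Set.to_countable _) fun A _ => h A

/-- The feedback reveals no more than the full vectors: by induction on the round, since the
decisions masking the feedback depend on earlier feedback only. -/
lemma history_le_past {X : Finset (Finset (Fin d))} {Z : ℕ → Fin d → Ω → ℝ}
    {x : ℕ → Ω → Finset (Fin d)} (hx : IsPolicy X Z x) (t : ℕ) :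
    history Z x t ≤ past Z t := by
  induction t using Nat.strong_induction_on with
  | _ t ih =>
    refine iSup₂_le fun s hs => iSup_le fun i => ?_
    rw [Finset.mem_Ico] at hs
    rw [← measurable_iff_comap_le]
    have h1 : ∀ A, MeasurableSet[past Z t] {ω | x s ω = A} := fun A =>
      (past_mono Z hs.2.le) _ (ih s hs.2 _ (hx.adapted s hs.1 A))
    exact Measurable.ite (measurableSet_mem_of_eq h1 i) (measurable_past Z hs.1 hs.2 i)
      measurable_const

lemma IsPolicy.measurableSet_eq {X : Finset (Finset (Fin d))} {Z : ℕ → Fin d → Ω → ℝ}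
    {x : ℕ → Ω → Finset (Fin d)} (hx : IsPolicy X Z x) {s t : ℕ} (hs : 1 ≤ s) (hst : s ≤ t)
    (A : Finset (Fin d)) : MeasurableSet[past Z t] {ω | x s ω = A} :=
  (past_mono Z hst) _ (history_le_past hx s _ (hx.adapted s hs A))

lemma IsPolicy.measurableSet_mem {X : Finset (Finset (Fin d))} {Z : ℕ → Fin d → Ω → ℝ}
    {x : ℕ → Ω → Finset (Fin d)} (hx : IsPolicy X Z x) {s t : ℕ} (hs : 1 ≤ s) (hst : s ≤ t)
    (i : Fin d) : MeasurableSet[past Z t] {ω | i ∈ x s ω} :=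
  measurableSet_mem_of_eq (hx.measurableSet_eq hs hst) i

/-! ### Normalized exponentials of the observations of one entry -/

section Observations

/-- The centred sum `∑_{s<t} x_i(s) (Z_i(s) - θ_i)` of the observations of entry `i`. -/
def devSum (Z : ℕ → Fin d → Ω → ℝ) (θ : Fin d → ℝ) (x : ℕ → Ω → Finset (Fin d)) (t : ℕ)
    (i : Fin d) (ω : Ω) : ℝ :=
  ∑ s ∈ Finset.Ico 1 t, if i ∈ x s ω then Z s i ω - θ i else 0

/-- The normalized exponential `exp (l S_i(t) - n_i(t) l² / 8)` of the centred sum `S_i(t)`. -/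
def expDev (Z : ℕ → Fin d → Ω → ℝ) (θ : Fin d → ℝ) (x : ℕ → Ω → Finset (Fin d)) (l : ℝ) (t : ℕ)
    (i : Fin d) (ω : Ω) : ℝ :=
  Real.exp (l * devSum Z θ x t i ω - count x t i ω * (l ^ 2 / 8))

lemma expDev_nonneg {Z : ℕ → Fin d → Ω → ℝ} {θ : Fin d → ℝ} {x : ℕ → Ω → Finset (Fin d)}
    (l : ℝ) (t : ℕ) (i : Fin d) (ω : Ω) : 0 ≤ expDev Z θ x l t i ω :=
  (Real.exp_pos _).le

variable {Z : ℕ → Fin d → Ω → ℝ} {θ : Fin d → ℝ} {X : Finset (Finset (Fin d))}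
  {x : ℕ → Ω → Finset (Fin d)}

lemma devSum_succ {t : ℕ} (ht : 1 ≤ t) (i : Fin d) (ω : Ω) :
    devSum Z θ x (t + 1) i ω = devSum Z θ x t i ω + if i ∈ x t ω then Z t i ω - θ i else 0 := by
  rw [devSum, Finset.sum_Ico_succ_top ht]; rfl

lemma count_succ {t : ℕ} (ht : 1 ≤ t) (i : Fin d) (ω : Ω) :
    count x (t + 1) i ω = count x t i ω + if i ∈ x t ω then 1 else 0 := by
  rw [count, Finset.sum_Ico_succ_top ht]; rfl

lemma expDev_succ (l : ℝ) {t : ℕ} (ht : 1 ≤ t) (i : Fin d) (ω : Ω) :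
    expDev Z θ x l (t + 1) i ω = expDev Z θ x l t i ω *
      Real.exp (if i ∈ x t ω then l * (Z t i ω - θ i) - l ^ 2 / 8 else 0) := by
  rw [expDev, expDev, devSum_succ ht, count_succ ht, ← Real.exp_add]
  congr 1
  split_ifs <;> push_cast <;> ring

lemma measurable_count (hx : IsPolicy X Z x) (t : ℕ) (i : Fin d) :
    Measurable[past Z t] (count x t i) := by
  have : count x t i = fun ω => ∑ s ∈ Finset.Ico 1 t, if i ∈ x s ω then 1 else 0 := rfl
  rw [this]
  refine Finset.measurable_sum _ fun s hs => ?_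
  rw [Finset.mem_Ico] at hs
  exact Measurable.ite (hx.measurableSet_mem hs.1 hs.2.le i) measurable_const measurable_const

lemma measurable_devSum (hx : IsPolicy X Z x) (θ : Fin d → ℝ) (t : ℕ) (i : Fin d) :
    Measurable[past Z t] (devSum Z θ x t i) := by
  have : devSum Z θ x t i =
    fun ω => ∑ s ∈ Finset.Ico 1 t, if i ∈ x s ω then Z s i ω - θ i else 0 := rfl
  rw [this]
  refine Finset.measurable_sum _ fun s hs => ?_
  rw [Finset.mem_Ico] at hs
  exact Measurable.ite (hx.measurableSet_mem hs.1 hs.2.le i)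
    ((measurable_past Z hs.1 hs.2 i).sub_const _) measurable_const

lemma measurable_expDev (hx : IsPolicy X Z x) (θ : Fin d → ℝ) (l : ℝ) (t : ℕ) (i : Fin d) :
    Measurable[past Z t] (expDev Z θ x l t i) := by
  refine Real.measurable_exp.comp (((measurable_devSum hx θ t i).const_mul l).sub ?_)
  exact (measurable_from_nat.comp (measurable_count hx t i)).mul_const _

lemma count_lt {t : ℕ} (ht : 1 ≤ t) (i : Fin d) (ω : Ω) : count x t i ω < t := by
  have : count x t i ω ≤ ∑ s ∈ Finset.Ico 1 t, 1 :=
    Finset.sum_le_sum fun s _ => by split_ifs <;> simp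
  simp at this; omega

lemma measurable_level (hx : IsPolicy X Z x) (i : Fin d) (c l : ℕ → ℝ) {s : ℕ} (hs : 1 ≤ s) :
    Measurable[past Z s] (fun ω => if i ∈ x s ω then
      c (count x s i ω) * expDev Z θ x (l (count x s i ω)) s i ω else 0) := by
  have hc := measurable_count hx s i
  refine Measurable.ite (hx.measurableSet_mem hs le_rfl i) ?_ measurable_const
  refine (measurable_from_nat.comp hc).mul (Real.measurable_exp.comp ?_)
  refine ((measurable_from_nat.comp hc).mul (measurable_devSum hx θ s i)).sub ?_
  exact (measurable_from_nat (f := fun n : ℕ => (n : ℝ) * (l n ^ 2 / 8))).comp hc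

end Observations

/-! ### Exponential supermartingales of a policy -/

section Environment

variable [mΩ : MeasurableSpace Ω] {μ : Measure Ω} {θ : Fin d → ℝ} {Z : ℕ → Fin d → Ω → ℝ}

lemma IsEnvironment.past_le (hZ : IsEnvironment μ θ Z) (t : ℕ) : past Z t ≤ mΩ :=
  iSup₂_le fun p _ => (hZ.measurable (p.1 + 1) (by omega) p.2).comap_le

lemma IsEnvironment.present_le (hZ : IsEnvironment μ θ Z) (t : ℕ) : present Z t ≤ mΩ :=
  iSup₂_le fun p _ => (hZ.measurable (p.1 + 1) (by omega) p.2).comap_le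

lemma IsEnvironment.indep_past_present (hZ : IsEnvironment μ θ Z) (t : ℕ) :
    Indep (past Z t) (present Z t) μ := by
  refine indep_iSup_of_disjoint
    (m := fun p : ℕ × Fin d => MeasurableSpace.comap (Z (p.1 + 1) p.2) inferInstance)
    (fun p => (hZ.measurable (p.1 + 1) (by omega) p.2).comap_le) hZ.indep ?_
  rw [Set.disjoint_left]
  intro p hp hp'
  rw [Set.mem_ofPred_eq] at hp hp'
  omega

lemma IsEnvironment.mean' (hZ : IsEnvironment μ θ Z) {t : ℕ} (ht : 1 ≤ t) (i : Fin d) :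
    ∫ ω, Z t i ω ∂μ = θ i := by
  rw [← hZ.mean i]; exact (hZ.identDistrib t ht i).integral_eq

lemma IsEnvironment.mean_mem_Icc [IsProbabilityMeasure μ] (hZ : IsEnvironment μ θ Z) (i : Fin d) :
    θ i ∈ Set.Icc (0 : ℝ) 1 := by
  have hi : Integrable (Z 1 i) μ := Integrable.of_mem_Icc 0 1 (hZ.measurable 1 le_rfl i).aemeasurable
    (ae_of_all _ fun ω => hZ.mem_Icc 1 le_rfl i ω)
  rw [← hZ.mean i]
  constructor
  · exact integral_nonneg fun ω => (hZ.mem_Icc 1 le_rfl i ω).1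
  · calc ∫ ω, Z 1 i ω ∂μ ≤ ∫ _, (1 : ℝ) ∂μ :=
          integral_mono hi (integrable_const _) fun ω => (hZ.mem_Icc 1 le_rfl i ω).2
      _ = 1 := by simp

/-- Hoeffding's lemma, as a normalized exponential moment. -/
lemma IsEnvironment.lintegral_exp_le_one [IsProbabilityMeasure μ] (hZ : IsEnvironment μ θ Z)
    {t : ℕ} (ht : 1 ≤ t) (i : Fin d) (l : ℝ) :
    ∫⁻ ω, ENNReal.ofReal (Real.exp (l * (Z t i ω - θ i) - l ^ 2 / 8)) ∂μ ≤ 1 := by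
  have hsub := hasSubgaussianMGF_of_mem_Icc (μ := μ) (a := 0) (b := 1)
    (hZ.measurable t ht i).aemeasurable (ae_of_all _ fun ω => hZ.mem_Icc t ht i ω)
  have hint := hsub.integrable_exp_mul l
  have hle := hsub.mgf_le l
  rw [hZ.mean' ht i] at hint hle
  have heq : ∀ ω, Real.exp (l * (Z t i ω - θ i) - l ^ 2 / 8)
      = Real.exp (l * (Z t i ω - θ i)) * Real.exp (-(l ^ 2 / 8)) := fun ω => by
    rw [← Real.exp_add]; congr 1
  simp_rw [heq]
  rw [← ofReal_integral_eq_lintegral_ofReal (hint.mul_const _) (ae_of_all _ fun ω => by positivity),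
    integral_mul_const, ENNReal.ofReal_le_one]
  calc _ ≤ Real.exp (l ^ 2 / 8) * Real.exp (-(l ^ 2 / 8)) := by
        refine mul_le_mul_of_nonneg_right (hle.trans ?_) (Real.exp_pos _).le
        rw [Real.exp_le_exp]
        norm_num
        apply le_of_eq; ring
    _ = 1 := by rw [← Real.exp_add]; simp

/-- Entries chosen without looking at the present round form a supermartingale increment: for a
fixed choice `A`, the product of the normalized exponentials has expectation at most one. -/
lemma IsEnvironment.lintegral_exp_sum_le_one [IsProbabilityMeasure μ] (hZ : IsEnvironment μ θ Z)
    {t : ℕ} (ht : 1 ≤ t) (A : Finset (Fin d)) (l : Fin d → ℝ) :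
    ∫⁻ ω, ENNReal.ofReal (Real.exp (∑ i ∈ A, (l i * (Z t i ω - θ i) - l i ^ 2 / 8))) ∂μ ≤ 1 := by
  have hind : iIndepFun (fun i : Fin d => Z t i) μ := by
    obtain ⟨s, rfl⟩ : ∃ r, t = r + 1 := ⟨t - 1, by omega⟩
    exact hZ.indep.precomp (g := fun i : Fin d => (s, i)) (fun i j h => by simpa using h)
  have hind' : iIndepFun (fun (i : Fin d) ω =>
      ENNReal.ofReal (Real.exp (l i * (Z t i ω - θ i) - l i ^ 2 / 8))) μ :=
    hind.comp (fun i z => ENNReal.ofReal (Real.exp (l i * (z - θ i) - l i ^ 2 / 8)))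
      (fun i => by fun_prop)
  simp_rw [Real.exp_sum, ENNReal.ofReal_prod_of_nonneg (fun _ _ => (Real.exp_pos _).le)]
  rw [lintegral_prod_eq_prod_lintegral_of_indepFun A _ hind' (fun i => by
    have := hZ.measurable t ht i
    fun_prop)]
  exact Finset.prod_le_one' fun i _ => hZ.lintegral_exp_le_one ht i (l i)

/-- One step of the exponential supermartingale, for a decision that depends on the past only. -/
lemma lintegral_mul_exp_le [IsProbabilityMeasure μ] {X : Finset (Finset (Fin d))}
    {x : ℕ → Ω → Finset (Fin d)} (hZ : IsEnvironment μ θ Z) (hx : IsPolicy X Z x)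
    {t : ℕ} (ht : 1 ≤ t) (l : Fin d → ℝ) {G : Ω → ENNReal} (hG : Measurable[past Z t] G) :
    ∫⁻ ω, G ω * ENNReal.ofReal
      (Real.exp (∑ i ∈ x t ω, (l i * (Z t i ω - θ i) - l i ^ 2 / 8))) ∂μ ≤ ∫⁻ ω, G ω ∂μ := by
  have hpl := hZ.past_le t
  set I : Finset (Fin d) → Ω → ENNReal := fun A => {ω | x t ω = A}.indicator G with hI
  set E : Finset (Fin d) → Ω → ENNReal := fun A ω => ENNReal.ofReal
      (Real.exp (∑ i ∈ A, (l i * (Z t i ω - θ i) - l i ^ 2 / 8))) with hE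
  have hIm : ∀ A, Measurable[past Z t] (I A) := fun A =>
    Measurable.indicator hG (hx.measurableSet_eq ht le_rfl A)
  have hEm : ∀ A, Measurable[present Z t] (E A) := fun A => by
    refine ENNReal.measurable_ofReal.comp (Real.measurable_exp.comp ?_)
    refine Finset.measurable_sum _ fun i _ => ?_
    exact (((measurable_present Z ht i).sub_const _).const_mul _).sub_const _
  have hsum : ∀ ω, G ω = ∑ A, I A ω := fun ω => by
    simp [hI, Set.indicator_apply]
  have hsum' : ∀ ω, G ω * E (x t ω) ω = ∑ A, I A ω * E A ω := fun ω => by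
    simp [hI, Set.indicator_apply]
  calc ∫⁻ ω, G ω * E (x t ω) ω ∂μ = ∑ A, ∫⁻ ω, I A ω * E A ω ∂μ := by
        simp_rw [hsum']
        exact lintegral_finsetSum _ fun A _ =>
          ((hIm A).mono hpl le_rfl).mul ((hEm A).mono (hZ.present_le t) le_rfl)
    _ ≤ ∑ A, ∫⁻ ω, I A ω ∂μ := by
        refine Finset.sum_le_sum fun A _ => ?_
        rw [lintegral_mul_eq_lintegral_mul_lintegral_of_independent_measurableSpace hpl
          (hZ.present_le t) (hZ.indep_past_present t) (hIm A) (hEm A)]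
        exact mul_le_of_le_one_right' (hZ.lintegral_exp_sum_le_one ht A l)
    _ = ∫⁻ ω, G ω ∂μ := by
        rw [← lintegral_finsetSum _ fun A _ => (hIm A).mono hpl le_rfl]
        simp_rw [← hsum]

variable {X : Finset (Finset (Fin d))} {x : ℕ → Ω → Finset (Fin d)}

/-- The exponential supermartingale of a policy, with one parameter for each entry of `A`. -/
lemma lintegral_prod_expDev_le_one [IsProbabilityMeasure μ] (hZ : IsEnvironment μ θ Z)
    (hx : IsPolicy X Z x) (A : Finset (Fin d)) (l : Fin d → ℝ) {t : ℕ} (ht : 1 ≤ t) :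
    ∫⁻ ω, ENNReal.ofReal (∏ i ∈ A, expDev Z θ x (l i) t i ω) ∂μ ≤ 1 := by
  induction t, ht using Nat.le_induction with
  | base => simp [expDev, devSum, count]
  | succ t ht ih =>
    refine le_trans (le_of_eq ?_) ((lintegral_mul_exp_le hZ hx ht
      (fun i => if i ∈ A then l i else 0)
      (G := fun ω => ENNReal.ofReal (∏ i ∈ A, expDev Z θ x (l i) t i ω)) ?_).trans ih)
    · refine lintegral_congr fun ω => ?_
      rw [← ENNReal.ofReal_mul (Finset.prod_nonneg fun i _ => expDev_nonneg _ _ _ _)]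
      congr 1
      simp_rw [expDev_succ _ ht]
      rw [Finset.prod_mul_distrib, ← Real.exp_sum]
      congr 2
      rw [← Finset.sum_filter, Finset.filter_mem_eq_inter, Finset.inter_comm,
        ← Finset.filter_mem_eq_inter, Finset.sum_filter]
      refine Finset.sum_congr rfl fun i _ => ?_
      split_ifs <;> simp
    · refine ENNReal.measurable_ofReal.comp ?_
      have := fun i : Fin d => measurable_expDev hx θ (l i) t i
      exact Finset.measurable_prod _ fun i _ => this i

/-- Optional skipping: entry `i` is played with exactly `n` previous observations at most once, and
the normalized exponential sampled at that round has expectation at most one. The second summand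
below keeps the supermartingale alive until that round. -/
lemma lintegral_level_add_le_one [IsProbabilityMeasure μ] (hZ : IsEnvironment μ θ Z)
    (hx : IsPolicy X Z x) (i : Fin d) (n : ℕ) (l : ℝ) {t : ℕ} (ht : 1 ≤ t) :
    ∫⁻ ω, (∑ s ∈ Finset.Ico 1 t, if i ∈ x s ω ∧ count x s i ω = n then
        ENNReal.ofReal (expDev Z θ x l s i ω) else 0) +
      (if count x t i ω ≤ n then ENNReal.ofReal (expDev Z θ x l t i ω) else 0) ∂μ ≤ 1 := by
  induction t, ht using Nat.le_induction with
  | base => simp [expDev, devSum, count]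
  | succ t ht ih =>
    refine le_trans ?_ ih
    set P : Ω → ENNReal := fun ω => ∑ s ∈ Finset.Ico 1 t, if i ∈ x s ω ∧ count x s i ω = n then
        ENNReal.ofReal (expDev Z θ x l s i ω) else 0 with hP
    set Q : Ω → ENNReal := fun ω => if i ∈ x t ω ∧ count x t i ω = n then
        ENNReal.ofReal (expDev Z θ x l t i ω) else 0 with hQ
    set G : Ω → ENNReal := fun ω => if count x t i ω ≤ n ∧ ¬ (i ∈ x t ω ∧ count x t i ω = n) then
        ENNReal.ofReal (expDev Z θ x l t i ω) else 0 with hG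
    have hc : ∀ s, Measurable[past Z s] (count x s i) := fun s => measurable_count hx s i
    have hm : ∀ s, 1 ≤ s → MeasurableSet[past Z s] {ω | i ∈ x s ω ∧ count x s i ω = n} := fun s hs =>
      (hx.measurableSet_mem hs le_rfl i).inter (hc s (measurableSet_singleton n))
    have hE : ∀ s, Measurable[past Z s] (fun ω => ENNReal.ofReal (expDev Z θ x l s i ω)) := fun s =>
      ENNReal.measurable_ofReal.comp (measurable_expDev hx θ l s i)
    have hGm : Measurable[past Z t] G := Measurable.ite
      ((hc t (measurableSet_Iic (a := n))).inter (hm t ht).compl) (hE t) measurable_const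
    have hPm : Measurable P := Finset.measurable_sum _ fun s hs =>
      Measurable.ite (hZ.past_le s _ (hm s (Finset.mem_Ico.1 hs).1))
        ((hE s).mono (hZ.past_le s) le_rfl) measurable_const
    have hQm : Measurable Q := Measurable.ite (hZ.past_le t _ (hm t ht))
        ((hE t).mono (hZ.past_le t) le_rfl) measurable_const
    have h1 : ∀ ω, ((∑ s ∈ Finset.Ico 1 (t + 1), if i ∈ x s ω ∧ count x s i ω = n then
        ENNReal.ofReal (expDev Z θ x l s i ω) else 0) +
      (if count x (t + 1) i ω ≤ n then ENNReal.ofReal (expDev Z θ x l (t + 1) i ω) else 0)) =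
        (P ω + Q ω) + G ω * ENNReal.ofReal (Real.exp (∑ j ∈ x t ω,
          ((if j = i then l else 0) * (Z t j ω - θ j) - (if j = i then l else 0) ^ 2 / 8))) := by
      intro ω
      rw [Finset.sum_Ico_succ_top ht]
      congr 1
      have h2 : (∑ j ∈ x t ω,
          ((if j = i then l else 0) * (Z t j ω - θ j) - (if j = i then l else 0) ^ 2 / 8)) =
          if i ∈ x t ω then l * (Z t i ω - θ i) - l ^ 2 / 8 else 0 := by
        rw [← Finset.sum_ite_eq' (x t ω) i (fun j => l * (Z t j ω - θ j) - l ^ 2 / 8)]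
        refine Finset.sum_congr rfl fun j _ => ?_
        split_ifs <;> simp
      rw [h2, hG, expDev_succ l ht, ENNReal.ofReal_mul (expDev_nonneg _ _ _ _), count_succ ht]
      by_cases hi : i ∈ x t ω
      · by_cases hn : count x t i ω = n
        · simp [hi, hn]
        · have : count x t i ω + 1 ≤ n ↔ count x t i ω ≤ n := by omega
          simp [hi, hn, this]
      · simp [hi]
    refine (lintegral_congr h1).trans_le ?_
    have h3 : ∀ ω, P ω + (if count x t i ω ≤ n then ENNReal.ofReal (expDev Z θ x l t i ω) else 0) =
        (P ω + Q ω) + G ω := by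
      intro ω
      rw [add_assoc]
      congr 1
      by_cases hi : i ∈ x t ω <;> by_cases hn : count x t i ω = n <;> simp [hQ, hG, hi, hn]
    refine le_trans ?_ (lintegral_congr h3).ge
    have hPQ : Measurable fun ω => P ω + Q ω := hPm.add hQm
    rw [lintegral_add_left hPQ, lintegral_add_left hPQ]
    exact add_le_add le_rfl (lintegral_mul_exp_le hZ hx ht _ hGm)

/-- Summing over the rounds at which entry `i` is played a quantity that depends on the number
`n_i` of its past observations, and is damped by the normalized exponential with a parameter that
depends on `n_i`, costs in expectation at most the sum over the possible values of `n_i`. -/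
lemma lintegral_sum_level_le [IsProbabilityMeasure μ] (hZ : IsEnvironment μ θ Z)
    (hx : IsPolicy X Z x) (i : Fin d) (c l : ℕ → ℝ) (hc : ∀ n, 0 ≤ c n) (T : ℕ) :
    ∫⁻ ω, ENNReal.ofReal (∑ s ∈ Finset.Icc 1 T, if i ∈ x s ω then
      c (count x s i ω) * expDev Z θ x (l (count x s i ω)) s i ω else 0) ∂μ ≤
      ENNReal.ofReal (∑ n ∈ Finset.range T, c n) := by
  have hnn : ∀ s ω, 0 ≤ if i ∈ x s ω then
      c (count x s i ω) * expDev Z θ x (l (count x s i ω)) s i ω else 0 := fun s ω => by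
    split_ifs
    · exact mul_nonneg (hc _) (Real.exp_pos _).le
    · exact le_rfl
  have h1 : ∀ ω, ENNReal.ofReal (∑ s ∈ Finset.Icc 1 T, if i ∈ x s ω then
      c (count x s i ω) * expDev Z θ x (l (count x s i ω)) s i ω else 0) =
      ∑ n ∈ Finset.range T, ENNReal.ofReal (c n) * ∑ s ∈ Finset.Ico 1 (T + 1),
        if i ∈ x s ω ∧ count x s i ω = n then
          ENNReal.ofReal (expDev Z θ x (l n) s i ω) else 0 := by
    intro ω
    rw [ENNReal.ofReal_sum_of_nonneg fun s _ => hnn s ω]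
    simp_rw [Finset.mul_sum]
    rw [Finset.sum_comm]
    refine Finset.sum_congr rfl fun s hs => ?_
    rw [Finset.mem_Ico] at hs
    by_cases hi : i ∈ x s ω
    · have hlt := count_lt (x := x) hs.1 i ω
      simp only [hi, true_and, if_true, mul_ite, mul_zero]
      rw [Finset.sum_ite_eq, if_pos (Finset.mem_range.2 (by omega)), ENNReal.ofReal_mul (hc _)]
    · simp [hi]
  simp_rw [h1]
  have hmeas : ∀ n, Measurable fun ω => ∑ s ∈ Finset.Ico 1 (T + 1),
        if i ∈ x s ω ∧ count x s i ω = n then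
          ENNReal.ofReal (expDev Z θ x (l n) s i ω) else 0 := fun n =>
    Finset.measurable_sum _ fun s hs => Measurable.ite (hZ.past_le s _
      ((hx.measurableSet_mem (Finset.mem_Ico.1 hs).1 le_rfl i).inter
        (measurable_count hx s i (measurableSet_singleton n))))
      ((ENNReal.measurable_ofReal.comp (measurable_expDev hx θ (l n) s i)).mono
        (hZ.past_le s) le_rfl) measurable_const
  rw [lintegral_finsetSum _ fun n _ => (hmeas n).const_mul _,
    ENNReal.ofReal_sum_of_nonneg fun n _ => hc n]
  refine Finset.sum_le_sum fun n _ => ?_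
  rw [lintegral_const_mul _ (hmeas n)]
  refine mul_le_of_le_one_right' (le_trans ?_
    (lintegral_level_add_le_one hZ hx i n (l n) (t := T + 1) (by omega)))
  exact lintegral_mono fun ω => le_self_add

lemma integrable_and_integral_le {g : Ω → ℝ}
    (hg : Measurable g) (h0 : ∀ ω, 0 ≤ g ω) {c : ℝ} (hc : 0 ≤ c)
    (h : ∫⁻ ω, ENNReal.ofReal (g ω) ∂μ ≤ ENNReal.ofReal c) :
    Integrable g μ ∧ ∫ ω, g ω ∂μ ≤ c := by
  constructor
  · refine ⟨hg.aestronglyMeasurable, ?_⟩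
    rw [hasFiniteIntegral_iff_ofReal (ae_of_all _ h0)]
    exact h.trans_lt ENNReal.ofReal_lt_top
  · rw [integral_eq_lintegral_of_nonneg_ae (ae_of_all _ h0) hg.aestronglyMeasurable]
    exact ENNReal.toReal_le_of_le_ofReal hc h

lemma integral_sum_level_le [IsProbabilityMeasure μ] (hZ : IsEnvironment μ θ Z)
    (hx : IsPolicy X Z x) (i : Fin d) (c l : ℕ → ℝ) (hc : ∀ n, 0 ≤ c n) (T : ℕ) :
    Integrable (fun ω => ∑ s ∈ Finset.Icc 1 T, if i ∈ x s ω then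
      c (count x s i ω) * expDev Z θ x (l (count x s i ω)) s i ω else 0) μ ∧
    ∫ ω, (∑ s ∈ Finset.Icc 1 T, if i ∈ x s ω then
      c (count x s i ω) * expDev Z θ x (l (count x s i ω)) s i ω else 0) ∂μ ≤
      ∑ n ∈ Finset.range T, c n := by
  refine integrable_and_integral_le ?_ (fun ω => Finset.sum_nonneg fun s _ => ?_)
    (Finset.sum_nonneg fun n _ => hc n) (lintegral_sum_level_le hZ hx i c l hc T)
  · exact Finset.measurable_sum _ fun s hs =>
      (measurable_level hx i c l (Finset.mem_Icc.1 hs).1).mono (hZ.past_le s) le_rfl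
  · split_ifs
    · exact mul_nonneg (hc _) (Real.exp_pos _).le
    · exact le_rfl

lemma integral_prod_expDev_le_one [IsProbabilityMeasure μ] (hZ : IsEnvironment μ θ Z)
    (hx : IsPolicy X Z x) (A : Finset (Fin d)) (l : Fin d → ℝ) {t : ℕ} (ht : 1 ≤ t) :
    Integrable (fun ω => ∏ i ∈ A, expDev Z θ x (l i) t i ω) μ ∧
      ∫ ω, ∏ i ∈ A, expDev Z θ x (l i) t i ω ∂μ ≤ 1 := by
  refine integrable_and_integral_le ?_ (fun ω => Finset.prod_nonneg fun i _ => (Real.exp_pos _).le)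
    zero_le_one ((lintegral_prod_expDev_le_one hZ hx A l ht).trans (by simp))
  have := fun i : Fin d => (measurable_expDev hx θ (l i) t i).mono (hZ.past_le t) le_rfl
  exact Finset.measurable_prod _ fun i _ => this i

end Environment

/-! ### Elementary sums -/

lemma sqrt_succ_sub_sqrt (n : ℕ) :
    1 / (2 * √((n + 1 : ℕ) : ℝ)) ≤ √((n + 1 : ℕ) : ℝ) - √(n : ℝ) := by
  have h1 : 0 < √((n + 1 : ℕ) : ℝ) := Real.sqrt_pos.2 (by positivity)
  have h2 : √((n + 1 : ℕ) : ℝ) ^ 2 = n + 1 := by rw [Real.sq_sqrt (by positivity)]; push_cast; ring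
  have h3 : √(n : ℝ) ^ 2 = n := Real.sq_sqrt (by positivity)
  rw [div_le_iff₀ (by positivity)]
  nlinarith [sq_nonneg (√((n + 1 : ℕ) : ℝ) - √(n : ℝ))]

/-- Comparison with `∫ dx / (√x (1 + v √x)²) = 2 √x / (1 + v √x)`. -/
lemma sum_one_div_sqrt_mul_sq_le {v : ℝ} (hv : 0 < v) (T : ℕ) :
    ∑ n ∈ Finset.range T, 1 / (√(n : ℝ) * (1 + v * √(n : ℝ)) ^ 2) ≤ 2 / v := by
  have key : ∀ N : ℕ, ∑ n ∈ Finset.range (N + 1), 1 / (√(n : ℝ) * (1 + v * √(n : ℝ)) ^ 2) ≤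
      2 * √(N : ℝ) / (1 + v * √(N : ℝ)) := by
    intro N
    induction N with
    | zero => simp
    | succ N ih =>
      rw [Finset.sum_range_succ]
      have hd := sqrt_succ_sub_sqrt N
      have hp : 0 < √((N + 1 : ℕ) : ℝ) := Real.sqrt_pos.2 (by positivity)
      have hq : 0 ≤ √(N : ℝ) := Real.sqrt_nonneg _
      set p := √((N + 1 : ℕ) : ℝ)
      set q := √(N : ℝ)
      have hqp : q ≤ p := by
        have : 0 < 1 / (2 * p) := by positivity
        linarith
      have h1 : 2 * p / (1 + v * p) - 2 * q / (1 + v * q) =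
          2 * (p - q) / ((1 + v * p) * (1 + v * q)) := by
        have : 0 ≤ v * q := by positivity
        field_simp
        ring
      have h2 : 1 / (p * (1 + v * p) ^ 2) ≤ 2 * (p - q) / ((1 + v * p) * (1 + v * q)) := by
        calc 1 / (p * (1 + v * p) ^ 2) = 2 * (1 / (2 * p)) / ((1 + v * p) * (1 + v * p)) := by
              field_simp
          _ ≤ 2 * (p - q) / ((1 + v * p) * (1 + v * p)) := by gcongr
          _ ≤ 2 * (p - q) / ((1 + v * p) * (1 + v * q)) := by
              have : 0 ≤ p - q := by linarith
              gcongr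
      linarith
  cases T with
  | zero => simpa using by positivity
  | succ N =>
    refine (key N).trans ?_
    rw [div_le_div_iff₀ (by positivity) hv]
    nlinarith [Real.sqrt_nonneg (N : ℝ)]

/-- The share of the regret charged to an entry that has been observed `n` times. It vanishes at
`n = 0`, and is of order `D r / √n` up to `n = r²`, then of order `D r² / n` up to `n = m r²`. -/
def share (D r m : ℝ) (n : ℕ) : ℝ :=
  if (n : ℝ) < m * r ^ 2 then 2 * D * r ^ 2 / (√(n : ℝ) * (r + √(n : ℝ))) else 0

lemma share_nonneg {D r : ℝ} (hD : 0 ≤ D) (hr : 0 ≤ r) (m : ℝ) (n : ℕ) : 0 ≤ share D r m n := by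
  unfold share; split_ifs <;> positivity

/-- Comparison with `∫ r² dx / (√x (r + √x)) = 2 r² ln (r + √x)` on `[0, m r²]`. -/
lemma sum_share_le {D r : ℝ} (hD : 0 ≤ D) (hr : 0 < r) (m : ℝ) (T : ℕ) :
    ∑ n ∈ Finset.range T, share D r m n ≤ 4 * D * r ^ 2 * Real.log (1 + √m) := by
  have key : ∀ N : ℕ, ∑ n ∈ Finset.range (N + 1), share D r m n ≤
      4 * D * r ^ 2 * (Real.log (r + min (√(N : ℝ)) (r * √m)) - Real.log r) := by
    intro N
    induction N with
    | zero => simp [share, min_eq_left (show 0 ≤ r * √m by positivity)]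
    | succ N ih =>
      rw [Finset.sum_range_succ]
      have hd := sqrt_succ_sub_sqrt N
      have hp : 0 < √((N + 1 : ℕ) : ℝ) := Real.sqrt_pos.2 (by positivity)
      have hq : 0 ≤ √(N : ℝ) := Real.sqrt_nonneg _
      have hrm : 0 ≤ r * √m := by positivity
      suffices h : share D r m (N + 1) ≤ 4 * D * r ^ 2 *
          (Real.log (r + min (√((N + 1 : ℕ) : ℝ)) (r * √m)) -
            Real.log (r + min (√(N : ℝ)) (r * √m))) by
        linarith
      have hqp : √(N : ℝ) ≤ √((N + 1 : ℕ) : ℝ) := Real.sqrt_le_sqrt (by push_cast; linarith)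
      unfold share
      split_ifs with hlt
      · have hle : √((N + 1 : ℕ) : ℝ) ≤ r * √m := by
          rw [← Real.sqrt_sq hr.le, ← Real.sqrt_mul (by positivity)]
          exact Real.sqrt_le_sqrt (by linarith)
        rw [min_eq_left hle, min_eq_left (hqp.trans hle)]
        set p := √((N + 1 : ℕ) : ℝ)
        set q := √(N : ℝ)
        have h1 : 1 - (r + q) / (r + p) ≤ Real.log (r + p) - Real.log (r + q) := by
          rw [← Real.log_div (by positivity) (by positivity)]
          have := Real.one_sub_inv_le_log_of_pos (x := (r + p) / (r + q)) (by positivity)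
          rwa [inv_div] at this
        have h2 : 1 - (r + q) / (r + p) = (p - q) / (r + p) := by field_simp; ring
        have h3 : 1 / (2 * p) / (r + p) ≤ (p - q) / (r + p) := by gcongr
        calc 2 * D * r ^ 2 / (p * (r + p)) = 4 * D * r ^ 2 * (1 / (2 * p) / (r + p)) := by
              field_simp; ring
          _ ≤ _ := by gcongr; linarith
      · refine mul_nonneg (by positivity) (sub_nonneg.2 ?_)
        refine Real.log_le_log (by positivity) ?_
        gcongr
  cases T with
  | zero =>
    have : 0 ≤ Real.log (1 + √m) := Real.log_nonneg (by linarith [Real.sqrt_nonneg m])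
    simpa using by positivity
  | succ N =>
    refine (key N).trans ?_
    gcongr
    rw [← Real.log_div (by positivity) (by positivity)]
    refine Real.log_le_log (by positivity) ?_
    rw [div_le_iff₀ hr]
    have := min_le_right (√(N : ℝ)) (r * √m)
    linarith

/-- The charge of a round with gap `g`: if `∑ 1 / n_i ≥ g² / a` over at most `m` entries, then
the shares of these entries, with `r² = 2a/D²`, add up to at least `g`. -/
lemma le_sum_share {ι : Type*} {A : Finset ι} {n : ι → ℕ} (hn : ∀ i ∈ A, 1 ≤ n i) {m : ℕ}
    (hm : 2 ≤ m) (hA : A.card ≤ m) {D g a : ℝ} (hD : 0 < D) (hg : D ≤ g) (ha : 0 < a)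
    (h : g ^ 2 ≤ a * ∑ i ∈ A, 1 / (n i : ℝ)) :
    g ≤ ∑ i ∈ A, share D (√(2 * a) / D) m (n i) := by
  have hg0 : 0 < g := hD.trans_le hg
  set r := √(2 * a) / D with hr
  have hr0 : 0 < r := by positivity
  have hrD : D ^ 2 * r ^ 2 = 2 * a := by
    rw [hr, div_pow, Real.sq_sqrt (by positivity)]; field_simp
  have hm0 : (2 : ℝ) ≤ m := by exact_mod_cast hm
  by_cases hcase : ∃ i ∈ A, (n i : ℝ) ≤ 2 * a / g ^ 2
  · obtain ⟨i, hi, hni⟩ := hcase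
    refine le_trans ?_ (Finset.single_le_sum (f := fun i => share D r m (n i))
      (fun j _ => share_nonneg hD.le hr0.le _ _) hi)
    have hn0 : (0 : ℝ) < n i := by exact_mod_cast hn i hi
    have hnr : (n i : ℝ) * g ^ 2 ≤ D ^ 2 * r ^ 2 := by
      rw [hrD]; rwa [le_div_iff₀ (by positivity)] at hni
    have hs : √(n i : ℝ) * g ≤ D * r := by
      refine abs_le_of_sq_le_sq' ?_ (by positivity) |>.2
      rw [mul_pow, mul_pow, Real.sq_sqrt hn0.le]; exact hnr
    have hs' : √(n i : ℝ) ≤ r := by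
      have : √(n i : ℝ) * D ≤ r * D := by
        calc √(n i : ℝ) * D ≤ √(n i : ℝ) * g := by gcongr
          _ ≤ r * D := by linarith
      exact le_of_mul_le_mul_right this hD
    have hlt : (n i : ℝ) < m * r ^ 2 := by
      have : (n i : ℝ) ≤ r ^ 2 := by
        rw [← Real.sq_sqrt hn0.le]; gcongr
      nlinarith [sq_pos_of_pos hr0]
    have hsn : 0 < √(n i : ℝ) := Real.sqrt_pos.2 hn0
    simp only [share, if_pos hlt]
    rw [le_div_iff₀ (by positivity)]
    calc g * (√(n i : ℝ) * (r + √(n i : ℝ))) = (√(n i : ℝ) * g) * (r + √(n i : ℝ)) := by ring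
      _ ≤ (D * r) * (r + r) := by gcongr
      _ = _ := by ring
  · push Not at hcase
    -- entries with at least `2ma/g²` observations contribute at most half of the required sum
    set B := A.filter fun i => (n i : ℝ) < m * (2 * a / g ^ 2) with hB
    have hsplit := Finset.sum_filter_add_sum_filter_not A
      (fun i => (n i : ℝ) < m * (2 * a / g ^ 2)) fun i => 1 / (n i : ℝ)
    have hrest : ∑ i ∈ A.filter fun i => ¬ (n i : ℝ) < m * (2 * a / g ^ 2), 1 / (n i : ℝ) ≤
        g ^ 2 / (2 * a) := by
      calc _ ≤ ∑ i ∈ A.filter fun i => ¬ (n i : ℝ) < m * (2 * a / g ^ 2),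
              1 / (m * (2 * a / g ^ 2)) := by
            refine Finset.sum_le_sum fun i hi => ?_
            rw [Finset.mem_filter, not_lt] at hi
            exact one_div_le_one_div_of_le (by positivity) hi.2
        _ ≤ m * (1 / (m * (2 * a / g ^ 2))) := by
            rw [Finset.sum_const, nsmul_eq_mul]
            gcongr
            exact (Finset.card_filter_le _ _).trans hA
        _ = _ := by field_simp
    have hmain : g ^ 2 / (2 * a) ≤ ∑ i ∈ B, 1 / (n i : ℝ) := by
      have : g ^ 2 / a ≤ ∑ i ∈ A, 1 / (n i : ℝ) := by rwa [div_le_iff₀' ha]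
      have h2 : g ^ 2 / a = g ^ 2 / (2 * a) + g ^ 2 / (2 * a) := by field_simp; ring
      linarith
    calc g = (2 * a / g) * (g ^ 2 / (2 * a)) := by field_simp
      _ ≤ (2 * a / g) * ∑ i ∈ B, 1 / (n i : ℝ) := by gcongr
      _ = ∑ i ∈ B, (2 * a / g) * (1 / (n i : ℝ)) := Finset.mul_sum _ _ _
      _ ≤ ∑ i ∈ B, share D r m (n i) := by
          refine Finset.sum_le_sum fun i hi => ?_
          rw [hB, Finset.mem_filter] at hi
          have hn0 : (0 : ℝ) < n i := by exact_mod_cast hn i hi.1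
          have hsn : 0 < √(n i : ℝ) := Real.sqrt_pos.2 hn0
          have hsq : √(n i : ℝ) * √(n i : ℝ) = n i := Real.mul_self_sqrt hn0.le
          have hnlow : 2 * a < n i * g ^ 2 := by
            have := hcase i hi.1
            rwa [div_lt_iff₀ (by positivity)] at this
          have hlt : (n i : ℝ) < m * r ^ 2 := by
            refine hi.2.trans_le ?_
            gcongr
            rw [div_le_iff₀ (by positivity), ← hrD, mul_comm]
            gcongr
          have hsg : D * r ≤ √(n i : ℝ) * g := by
            refine abs_le_of_sq_le_sq' ?_ (by positivity) |>.2
            rw [mul_pow, mul_pow, Real.sq_sqrt hn0.le, hrD]; exact hnlow.le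
          simp only [share, if_pos hlt]
          rw [div_mul_div_comm, mul_one, div_le_div_iff₀ (by positivity) (by positivity), ← hrD]
          have hfac : D * (r + √(n i : ℝ)) ≤ 2 * (√(n i : ℝ) * g) := by
            have : D * √(n i : ℝ) ≤ g * √(n i : ℝ) := by gcongr
            linarith
          calc D ^ 2 * r ^ 2 * (√(n i : ℝ) * (r + √(n i : ℝ)))
              = (D * r ^ 2 * √(n i : ℝ)) * (D * (r + √(n i : ℝ))) := by ring
            _ ≤ (D * r ^ 2 * √(n i : ℝ)) * (2 * (√(n i : ℝ) * g)) := by gcongr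
            _ = 2 * D * r ^ 2 * (g * (√(n i : ℝ) * √(n i : ℝ))) := by ring
            _ = _ := by rw [hsq]
      _ ≤ ∑ i ∈ A, share D r m (n i) :=
          Finset.sum_le_sum_of_subset_of_nonneg (Finset.filter_subset _ _)
            fun i _ _ => share_nonneg hD.le hr0.le _ _

/-- The geometric tail from `n = 3` on leaves room for one more unit below `1 / b`. -/
lemma one_add_sum_exp_le {b : ℝ} (hb : 0 < b) (hb' : b ≤ 1 / 2) (T : ℕ) :
    1 + ∑ n ∈ Finset.range T, (if 3 ≤ n then Real.exp (-(b * n)) else 0) ≤ 1 / b := by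
  have key : ∀ N : ℕ, ∑ n ∈ Finset.range (N + 3), (if 3 ≤ n then Real.exp (-(b * n)) else 0) ≤
      (Real.exp (-(2 * b)) - Real.exp (-(b * (N + 2 : ℕ)))) / b := by
    intro N
    induction N with
    | zero => norm_num [Finset.sum_range_succ]; ring_nf; simp
    | succ N ih =>
      rw [show N + 1 + 3 = (N + 3) + 1 by ring, Finset.sum_range_succ, if_pos (by omega)]
      have h1 : Real.exp (-(b * ((N + 2 : ℕ) : ℝ))) =
          Real.exp b * Real.exp (-(b * ((N + 3 : ℕ) : ℝ))) := by
        rw [← Real.exp_add]; congr 1; push_cast; ring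
      have h2 := Real.add_one_le_exp b
      have h3 := Real.exp_pos (-(b * ((N + 3 : ℕ) : ℝ)))
      have h4 : Real.exp (-(b * ((N + 3 : ℕ) : ℝ))) ≤ (Real.exp (-(b * ((N + 2 : ℕ) : ℝ))) -
          Real.exp (-(b * ((N + 3 : ℕ) : ℝ)))) / b := by
        rw [le_div_iff₀ hb, h1]
        nlinarith
      rw [show N + 1 + 2 = N + 3 by ring]
      calc _ ≤ (Real.exp (-(2 * b)) - Real.exp (-(b * (N + 2 : ℕ)))) / b + _ := by gcongr
        _ ≤ _ := add_le_add_right h4 _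
        _ = _ := by ring
  have h5 : ∑ n ∈ Finset.range T, (if 3 ≤ n then Real.exp (-(b * n)) else 0) ≤
      Real.exp (-(2 * b)) / b := by
    calc _ ≤ ∑ n ∈ Finset.range (T + 3), (if 3 ≤ n then Real.exp (-(b * n)) else 0) :=
          Finset.sum_le_sum_of_subset_of_nonneg (Finset.range_subset_range.2 (by omega))
            fun n _ _ => by split_ifs <;> positivity
      _ ≤ _ := key T
      _ ≤ _ := by gcongr; linarith [Real.exp_pos (-(b * ((T + 2 : ℕ) : ℝ)))]
  have h6 : Real.exp (-(2 * b)) ≤ 1 - b := by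
    rw [Real.exp_neg]
    calc (Real.exp (2 * b))⁻¹ ≤ (2 * b + 1)⁻¹ := by
          gcongr; exact Real.add_one_le_exp _
      _ ≤ 1 - b := by
          rw [inv_le_iff_one_le_mul₀ (by positivity)]; nlinarith
  calc _ ≤ 1 + Real.exp (-(2 * b)) / b := by gcongr
    _ ≤ 1 + (1 - b) / b := by gcongr
    _ = 1 / b := by field_simp; ring

lemma one_lt_log_three : 1 < Real.log 3 := by linarith [Real.log_three_gt_d9]

lemma one_le_log_of_three_le {t : ℕ} (ht : 3 ≤ t) : 1 ≤ Real.log t :=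
  one_lt_log_three.le.trans (Real.log_le_log (by norm_num) (by exact_mod_cast ht))

/-- Comparison with `∫ dx / (x ln² x) = -1 / ln x`. -/
lemma sum_one_div_mul_log_sq_le (T : ℕ) :
    ∑ t ∈ Finset.Icc 3 T, 1 / (t * Real.log t ^ 2) ≤ 2 := by
  have key : ∀ N : ℕ, ∑ t ∈ Finset.Icc 3 (N + 2), 1 / ((t : ℝ) * Real.log t ^ 2) ≤
      1 / Real.log 2 - 1 / Real.log (N + 2 : ℕ) := by
    intro N
    induction N with
    | zero => simp
    | succ N ih =>
      rw [show N + 1 + 2 = (N + 2) + 1 by ring, Finset.sum_Icc_succ_top (by omega)]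
      have hp : 0 < Real.log ((N + 2 : ℕ) : ℝ) := Real.log_pos (by push_cast; linarith)
      have hpq : Real.log ((N + 2 : ℕ) : ℝ) ≤ Real.log ((N + 2 + 1 : ℕ) : ℝ) :=
        Real.log_le_log (by positivity) (by push_cast; linarith)
      have h1 : 1 / ((N + 2 + 1 : ℕ) : ℝ) ≤
          Real.log ((N + 2 + 1 : ℕ) : ℝ) - Real.log ((N + 2 : ℕ) : ℝ) := by
        rw [← Real.log_div (by positivity) (by positivity)]
        refine le_trans (le_of_eq ?_) (Real.one_sub_inv_le_log_of_pos (by positivity))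
        push_cast; field_simp; ring
      set p := Real.log ((N + 2 : ℕ) : ℝ)
      set q := Real.log ((N + 2 + 1 : ℕ) : ℝ)
      have hq : 0 < q := hp.trans_le hpq
      have h2 : 1 / p - 1 / q = (q - p) / (p * q) := by field_simp
      have h3 : 1 / (((N + 2 + 1 : ℕ) : ℝ) * q ^ 2) ≤ 1 / p - 1 / q := by
        rw [h2]
        calc 1 / (((N + 2 + 1 : ℕ) : ℝ) * q ^ 2) = 1 / ((N + 2 + 1 : ℕ) : ℝ) / (q * q) := by
              rw [div_div, sq]
          _ ≤ (q - p) / (q * q) := by gcongr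
          _ ≤ (q - p) / (p * q) := by
              have : 0 ≤ q - p := by linarith
              gcongr
      linarith
  have hl2 : 1 / Real.log 2 ≤ 2 := by
    rw [div_le_iff₀ (Real.log_pos (by norm_num))]; linarith [Real.log_two_gt_d9]
  calc _ ≤ ∑ t ∈ Finset.Icc 3 (T + 2), 1 / ((t : ℝ) * Real.log t ^ 2) :=
        Finset.sum_le_sum_of_subset_of_nonneg (Finset.Icc_subset_Icc_right (by omega))
          fun n _ _ => by positivity
    _ ≤ _ := key T
    _ ≤ 2 := by
        have : 0 ≤ 1 / Real.log ((T + 2 : ℕ) : ℝ) :=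
          one_div_nonneg.2 (Real.log_natCast_nonneg _)
        linarith

/-! ### The exploration function -/

lemma explore_nonneg (m t : ℕ) : 0 ≤ explore m t := by
  have := Real.log_natCast_nonneg t
  unfold explore; positivity

lemma log_le_explore (m t : ℕ) : Real.log t ≤ explore m t := by
  have : 0 ≤ 4 * (m : ℝ) * max (Real.log (Real.log t)) 0 := by positivity
  unfold explore; linarith

lemma explore_mono (m : ℕ) {s t : ℕ} (hs : 1 ≤ s) (h : s ≤ t) : explore m s ≤ explore m t := by
  have hs0 : (0 : ℝ) < s := by exact_mod_cast hs
  have hst : (s : ℝ) ≤ t := by exact_mod_cast h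
  unfold explore
  have hl : Real.log s ≤ Real.log t := Real.log_le_log hs0 hst
  gcongr ?_ + 4 * _ * ?_
  rcases hs.eq_or_lt with rfl | hs1
  · simp
  · have : 0 < Real.log s := Real.log_pos (by exact_mod_cast hs1)
    exact max_le_max (Real.log_le_log this hl) le_rfl

lemma explore_eq {m t : ℕ} (ht : 3 ≤ t) :
    explore m t = Real.log t + 4 * m * Real.log (Real.log t) := by
  rw [explore, max_eq_left (Real.log_nonneg (one_le_log_of_three_le ht))]

lemma explore_le {m t : ℕ} (ht : 3 ≤ t) : explore m t ≤ (1 + 4 * m) * Real.log t := by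
  have h1 := one_le_log_of_three_le ht
  have := Real.log_le_self (x := Real.log t) (by linarith)
  rw [explore_eq ht, add_mul, one_mul]
  gcongr

lemma one_le_explore {t : ℕ} (m : ℕ) (ht : 3 ≤ t) : 1 ≤ explore m t :=
  (one_le_log_of_three_le ht).trans (log_le_explore m t)

lemma exp_neg_explore {m t : ℕ} (ht : 3 ≤ t) :
    Real.exp (-explore m t) = 1 / (t * Real.log t ^ (4 * m)) := by
  have h1 := one_le_log_of_three_le ht
  have h2 : (0 : ℝ) < t := by positivity
  rw [explore_eq ht, Real.exp_neg, Real.exp_add, Real.exp_log h2, one_div]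
  congr 2
  rw [show 4 * (m : ℝ) * Real.log (Real.log t) = ((4 * m : ℕ) : ℝ) * Real.log (Real.log t) by
    push_cast; ring, Real.exp_nat_mul, Real.exp_log (by linarith)]

/-! ### A finite grid of exponential parameters -/

/-- A geometric grid, together with `0`: for a level at most `f` and at most `t` observations it
contains a parameter whose loss in the Chernoff exponent is at most one. -/
def grid (f : ℝ) (t : ℕ) : Finset ℝ :=
  insert 0 ((Finset.range (⌈f * (Real.log (f * t) / 2)⌉₊ + 1)).image
    fun j : ℕ => √(8 * f) * Real.exp (-(j / f)))

lemma grid_card_le {f : ℝ} {t : ℕ} (ht : 1 ≤ t) (hf : 1 ≤ f) (hft : Real.log t ≤ f) :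
    ((grid f t).card : ℝ) ≤ 4 * f ^ 2 := by
  have h1 : (grid f t).card ≤ ⌈f * (Real.log (f * t) / 2)⌉₊ + 1 + 1 := by
    refine (Finset.card_insert_le _ _).trans ?_
    gcongr
    exact Finset.card_image_le.trans (by simp)
  have ht0 : (1 : ℝ) ≤ t := by exact_mod_cast ht
  have h2 : Real.log (f * t) ≤ 2 * f := by
    rw [Real.log_mul (by positivity) (by positivity)]
    have := Real.log_le_self (x := f) (by linarith)
    linarith
  have h0 : 0 ≤ Real.log (f * t) := Real.log_nonneg (by nlinarith)
  have h3 := (Nat.ceil_lt_add_one (a := f * (Real.log (f * t) / 2)) (by positivity)).le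
  calc ((grid f t).card : ℝ) ≤ (⌈f * (Real.log (f * t) / 2)⌉₊ + 1 + 1 : ℕ) := by exact_mod_cast h1
    _ ≤ f * (Real.log (f * t) / 2) + 1 + 1 + 1 := by push_cast; linarith
    _ ≤ f * (2 * f / 2) + 1 + 1 + 1 := by gcongr
    _ ≤ 4 * f ^ 2 := by nlinarith

/-- The Chernoff exponent `2 y² / n` of a deviation `y`, capped at level `f`, is attained up to one
unit by a parameter of the grid. -/
lemma exists_mem_grid {f : ℝ} (hf : 1 ≤ f) {n t : ℕ} (hn : 1 ≤ n) (hnt : n ≤ t) (y : ℝ) :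
    ∃ l ∈ grid f t, min (2 * max y 0 ^ 2 / n) f - 1 ≤ l * y - n * (l ^ 2 / 8) := by
  have hn0 : (1 : ℝ) ≤ n := by exact_mod_cast hn
  have hnt0 : (n : ℝ) ≤ t := by exact_mod_cast hnt
  set L := min (2 * max y 0 ^ 2 / n) f with hL
  rcases le_or_gt L 1 with hL1 | hL1
  · exact ⟨0, Finset.mem_insert_self _ _, by simpa using hL1⟩
  have hLf : L ≤ f := min_le_right _ _
  have hy : 0 < y := by
    by_contra hy
    have : L ≤ 2 * max y 0 ^ 2 / n := min_le_left _ _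
    rw [max_eq_right (not_lt.1 hy)] at this
    norm_num at this
    linarith
  have hLy : L ≤ 2 * y ^ 2 / n := by
    have : L ≤ 2 * max y 0 ^ 2 / n := min_le_left _ _
    rwa [max_eq_left hy.le] at this
  -- the optimal parameter at level `L` is `√(8 L / n) = √(8 f) e^{-u}`
  set u := Real.log (f * n / L) / 2 with hu
  have hq : 1 ≤ f * n / L := by
    rw [le_div_iff₀ (by linarith)]; nlinarith
  have hu0 : 0 ≤ u := div_nonneg (Real.log_nonneg hq) (by norm_num)
  have hexpu : Real.exp (-u) ^ 2 = L / (f * n) := by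
    rw [← Real.exp_nat_mul, hu]
    rw [show ((2 : ℕ) : ℝ) * -(Real.log (f * n / L) / 2) = -Real.log (f * n / L) by push_cast; ring,
      Real.exp_neg, Real.exp_log (by linarith), inv_div]
  set j := ⌈f * u⌉₊ with hj
  have hj1 : f * u ≤ j := Nat.le_ceil _
  have hj2 : (j : ℝ) < f * u + 1 := Nat.ceil_lt_add_one (by positivity)
  refine ⟨√(8 * f) * Real.exp (-(j / f)), ?_, ?_⟩
  · refine Finset.mem_insert_of_mem (Finset.mem_image.2 ⟨j, ?_, rfl⟩)
    rw [Finset.mem_range, Nat.lt_succ_iff]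
    refine Nat.ceil_mono ?_
    have : f * n / L ≤ f * t := by
      rw [div_le_iff₀ (by linarith)]
      calc f * n ≤ f * t := by gcongr
        _ ≤ f * t * L := le_mul_of_one_le_right (by positivity) hL1.le
    rw [hu]
    gcongr
  · set s := (j : ℝ) / f - u with hs
    have hs0 : 0 ≤ s := by rw [hs, sub_nonneg, le_div_iff₀ (by linarith)]; linarith
    have hs1 : s ≤ 1 / f := by
      rw [hs, sub_le_iff_le_add, div_le_iff₀ (by linarith)]
      have : (1 / f + u) * f = 1 + f * u := by field_simp
      linarith
    set g := Real.exp (-s) with hg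
    have hg1 : 1 - s ≤ g := by have := Real.add_one_le_exp (-s); linarith
    have hg2 : g ≤ 1 := Real.exp_le_one_iff.2 (by linarith)
    have hgp : 0 < g := Real.exp_pos _
    have hl : √(8 * f) * Real.exp (-(j / f)) = √(8 * f) * Real.exp (-u) * g := by
      rw [mul_assoc, hg, ← Real.exp_add]; congr 2; rw [hs]; ring
    rw [hl]
    set k := √(8 * f) * Real.exp (-u) with hk
    have hk0 : 0 < k := by positivity
    have hk2 : n * k ^ 2 = 8 * L := by
      rw [hk, mul_pow, Real.sq_sqrt (by positivity), hexpu]; field_simp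
    have hky : 2 * L ≤ k * y := by
      refine abs_le_of_sq_le_sq' ?_ (by positivity) |>.2
      rw [mul_pow, mul_pow]
      have h1 : L * n ≤ 2 * y ^ 2 := by rwa [le_div_iff₀ (by linarith)] at hLy
      have h2 : k ^ 2 = 8 * L / n := by rw [← hk2]; field_simp
      have h3 : L * n * (4 * L) ≤ 2 * y ^ 2 * (4 * L) := by gcongr
      rw [h2, div_mul_eq_mul_div, le_div_iff₀ (by linarith)]
      nlinarith
    have h4 : L * (1 - g) ^ 2 ≤ 1 := by
      have h5 : (1 - g) ^ 2 ≤ (1 / f) ^ 2 := by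
        have : 0 ≤ 1 - g := by linarith
        have : 1 - g ≤ 1 / f := by linarith
        gcongr
      calc L * (1 - g) ^ 2 ≤ f * (1 / f) ^ 2 := by gcongr
        _ = 1 / f := by field_simp
        _ ≤ 1 := by rw [div_le_one (by linarith)]; exact hf
    have h6 : 2 * L * g ≤ k * y * g := by gcongr
    have h7 : (n : ℝ) * ((k * g) ^ 2 / 8) = L * g ^ 2 := by
      rw [mul_pow]; linear_combination (g ^ 2 / 8) * hk2
    rw [h7]
    nlinarith

/-- The constant in front of `1 / (t ln² t)` in the bound for the failure probability. -/
def failConst (m : ℕ) : ℝ := (4 * (1 + 4 * m) ^ 2) ^ m * Real.exp m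

lemma failConst_pos (m : ℕ) : 0 < failConst m := by unfold failConst; positivity

lemma grid_card_pow_mul_exp_le {m : ℕ} (hm : 1 ≤ m) {t : ℕ} (ht : 3 ≤ t) {k : ℕ} (hk : k ≤ m) :
    ((grid (explore m t) t).card : ℝ) ^ k * Real.exp (m - explore m t) ≤
      failConst m * (1 / (t * Real.log t ^ 2)) := by
  have hL := one_le_log_of_three_le ht
  have hc1 : (1 : ℝ) ≤ (grid (explore m t) t).card := by
    exact_mod_cast Finset.card_pos.2 ⟨0, Finset.mem_insert_self _ _⟩
  have hc2 := grid_card_le (by omega) (one_le_explore m ht) (log_le_explore m t)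
  have hc3 : ((grid (explore m t) t).card : ℝ) ≤ 4 * (1 + 4 * m) ^ 2 * Real.log t ^ 2 := by
    refine hc2.trans ?_
    rw [mul_assoc, ← mul_pow]
    have := explore_nonneg m t
    gcongr
    exact explore_le ht
  calc ((grid (explore m t) t).card : ℝ) ^ k * Real.exp (m - explore m t)
      ≤ ((grid (explore m t) t).card : ℝ) ^ m * Real.exp (m - explore m t) := by
        gcongr
    _ ≤ (4 * (1 + 4 * m) ^ 2 * Real.log t ^ 2) ^ m * Real.exp (m - explore m t) := by gcongr
    _ = failConst m * (Real.log t ^ (2 * m) * (1 / (t * Real.log t ^ (4 * m)))) := by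
        rw [sub_eq_add_neg, Real.exp_add, exp_neg_explore ht, failConst, mul_pow, ← pow_mul]; ring
    _ = failConst m * (1 / (t * Real.log t ^ (2 * m))) := by
        congr 1
        rw [show 4 * m = 2 * m + 2 * m by ring, pow_add]
        field_simp
    _ ≤ failConst m * (1 / (t * Real.log t ^ 2)) := by
        have := failConst_pos m
        have h3 : Real.log t ^ 2 ≤ Real.log t ^ (2 * m) := pow_le_pow_right₀ hL (by omega)
        gcongr

/-! ### Gaps -/

section Gaps

variable {d : ℕ} {X : Finset (Finset (Fin d))} {θ : Fin d → ℝ}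

lemma card_le_maxSize {A : Finset (Fin d)} (hA : A ∈ X) : A.card ≤ maxSize X :=
  Finset.le_sup (f := Finset.card) hA

lemma exists_reward_eq_optReward (hX : X.Nonempty) (θ : Fin d → ℝ) :
    ∃ A ∈ X, reward θ A = optReward X θ := by
  have hne : (reward θ '' (X : Set (Finset (Fin d)))).Nonempty := (Finset.coe_nonempty.2 hX).image _
  obtain ⟨A, hA, h⟩ := hne.csSup_mem (X.finite_toSet.image _)
  exact ⟨A, hA, h⟩

lemma gap_nonneg {A : Finset (Fin d)} (hA : A ∈ X) : 0 ≤ gap X θ A :=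
  sub_nonneg.2 (le_csSup (X.finite_toSet.image _).bddAbove (Set.mem_image_of_mem _ hA))

lemma reward_nonneg (hθ : ∀ i, θ i ∈ Set.Icc (0 : ℝ) 1) (A : Finset (Fin d)) : 0 ≤ reward θ A :=
  Finset.sum_nonneg fun i _ => (hθ i).1

lemma reward_le_card (hθ : ∀ i, θ i ∈ Set.Icc (0 : ℝ) 1) (A : Finset (Fin d)) :
    reward θ A ≤ A.card := by
  calc reward θ A ≤ ∑ i ∈ A, (1 : ℝ) := Finset.sum_le_sum fun i _ => (hθ i).2
    _ = A.card := by simp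

lemma gap_le_maxSize (hθ : ∀ i, θ i ∈ Set.Icc (0 : ℝ) 1) {A : Finset (Fin d)} (hA : A ∈ X) :
    gap X θ A ≤ maxSize X := by
  obtain ⟨B, hB, h⟩ := exists_reward_eq_optReward ⟨A, hA⟩ θ
  have h1 := reward_le_card hθ B
  have h2 := reward_nonneg hθ A
  have h3 : (B.card : ℝ) ≤ maxSize X := by exact_mod_cast card_le_maxSize hB
  rw [gap, ← h]; linarith

lemma finite_posGaps (X : Finset (Finset (Fin d))) (θ : Fin d → ℝ) :
    {g : ℝ | ∃ A ∈ X, gap X θ A = g ∧ 0 < g}.Finite := by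
  refine (X.finite_toSet.image (gap X θ)).subset ?_
  rintro g ⟨A, hA, h, -⟩
  exact ⟨A, hA, h⟩

lemma minGap_le_gap {A : Finset (Fin d)} (hA : A ∈ X) (h : 0 < gap X θ A) :
    minGap X θ ≤ gap X θ A :=
  csInf_le (finite_posGaps X θ).bddBelow ⟨A, hA, rfl, h⟩

lemma minGap_pos (h : ∃ A ∈ X, 0 < gap X θ A) : 0 < minGap X θ := by
  obtain ⟨A, hA, hpos⟩ := h
  have hne : {g : ℝ | ∃ A ∈ X, gap X θ A = g ∧ 0 < g}.Nonempty := ⟨_, A, hA, rfl, hpos⟩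
  obtain ⟨B, -, -, h⟩ := hne.csInf_mem (finite_posGaps X θ)
  exact h

end Gaps

/-! ### The index at a fixed sample point -/

section Index

variable {d : ℕ} {Ω : Type*} {X : Finset (Finset (Fin d))} {θ : Fin d → ℝ}
  {Z : ℕ → Fin d → Ω → ℝ} {x : ℕ → Ω → Finset (Fin d)} {ε δ : ℕ → ℝ}

/-- The squared exploration bonus `σ²(t)ᵀA` as a real number. This is the value used by the index
only if all entries of `A` have been observed (otherwise the index is infinite). -/
def width (m : ℕ) (x : ℕ → Ω → Finset (Fin d)) (t : ℕ) (ω : Ω) (A : Finset (Fin d)) : ℝ :=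
  ∑ i ∈ A, explore m t / (2 * count x t i ω)

lemma width_nonneg (m : ℕ) (x : ℕ → Ω → Finset (Fin d)) (t : ℕ) (ω : Ω) (A : Finset (Fin d)) :
    0 ≤ width m x t ω A :=
  Finset.sum_nonneg fun i _ => by have := explore_nonneg m t; positivity

lemma index_eq_coe {m : ℕ} {κ : ℝ} (hκ : 0 ≤ κ) {t : ℕ} {ω : Ω} {A : Finset (Fin d)}
    (hA : ∀ i ∈ A, 1 ≤ count x t i ω) :
    index m Z x κ t ω A =
      ((∑ i ∈ A, empMean Z x t i ω + κ * √(width m x t ω A) : ℝ) : EReal) := by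
  have h1 : ∑ i ∈ A, sigmaSq m x t i ω = ENNReal.ofReal (width m x t ω A) := by
    rw [width, ENNReal.ofReal_sum_of_nonneg
      fun i _ => by have := explore_nonneg m t; positivity]
    exact Finset.sum_congr rfl fun i hi => by rw [sigmaSq, if_pos (hA i hi)]
  have hw := width_nonneg m x t ω A
  rw [index, h1, ENNReal.ofReal_rpow_of_nonneg hw (by norm_num), ← ENNReal.ofReal_mul hκ,
    ← Real.sqrt_eq_rpow, EReal.coe_ennreal_ofReal, max_eq_left (by positivity), EReal.coe_add]

lemma index_eq_top {m : ℕ} {κ : ℝ} (hκ : 0 < κ) {t : ℕ} {ω : Ω} {A : Finset (Fin d)} {i : Fin d}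
    (hi : i ∈ A) (h : ¬ 1 ≤ count x t i ω) : index m Z x κ t ω A = ⊤ := by
  have h1 : ∑ i ∈ A, sigmaSq m x t i ω = ⊤ :=
    ENNReal.sum_eq_top.2 ⟨i, hi, by rw [sigmaSq, if_neg h]⟩
  rw [index, h1, ENNReal.top_rpow_of_pos (by norm_num),
    ENNReal.mul_top (by simpa using hκ), EReal.coe_ennreal_top, EReal.coe_add_top]

lemma empMean_eq {t : ℕ} {i : Fin d} {ω : Ω} (θ : Fin d → ℝ) (h : 1 ≤ count x t i ω) :
    empMean Z x t i ω = θ i + devSum Z θ x t i ω / count x t i ω := by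
  have h0 : (1 : ℝ) ≤ count x t i ω := by exact_mod_cast h
  have h1 : devSum Z θ x t i ω = ∑ s ∈ Finset.Ico 1 t, feedback Z x s i ω -
      count x t i ω * θ i := by
    rw [devSum, count, Nat.cast_sum, Finset.sum_mul, ← Finset.sum_sub_distrib]
    refine Finset.sum_congr rfl fun s _ => ?_
    rw [feedback]
    split_ifs <;> simp
  rw [empMean, max_eq_right h0, h1]
  field_simp
  ring

/-- If all entries of the decision played have been observed, so have all entries of all decisions
(an infinite index is beaten only by an infinite index), and the indices can be compared as reals. -/
lemma IsAESCB.index_le (hx : IsAESCB X Z ε δ x) {t : ℕ} (ht : 1 ≤ t) (hε : 0 < ε t) {ω : Ω}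
    (hobs : ∀ i ∈ x t ω, 1 ≤ count x t i ω) {B : Finset (Fin d)} (hB : B ∈ X) :
    (∀ i ∈ B, 1 ≤ count x t i ω) ∧
      ∑ i ∈ B, empMean Z x t i ω + √(width (maxSize X) x t ω B) ≤
        δ t + (∑ i ∈ x t ω, empMean Z x t i ω +
          1 / ε t * √(width (maxSize X) x t ω (x t ω))) := by
  have h := hx.near_opt t ht ω
  rw [index_eq_coe (one_div_nonneg.2 hε.le) hobs, ← EReal.coe_add] at h
  have hB' := (Finset.le_sup (f := fun B => index (maxSize X) Z x 1 t ω B) hB).trans h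
  have hobsB : ∀ i ∈ B, 1 ≤ count x t i ω := by
    by_contra hcon
    push Not at hcon
    obtain ⟨i, hi, hc⟩ := hcon
    simp only [index_eq_top (m := maxSize X) (Z := Z) one_pos hi (not_le.2 hc)] at hB'
    exact EReal.coe_ne_top _ (top_le_iff.1 hB')
  refine ⟨hobsB, ?_⟩
  simp only [index_eq_coe zero_le_one hobsB, one_mul] at hB'
  exact_mod_cast hB'

/-! ### Failure of optimism -/

/-- The parameter vectors used for the entries of `A` at time `t`. -/
def gridVectors (m t : ℕ) (A : Finset (Fin d)) : Finset (Fin d → ℝ) :=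
  Fintype.piFinset fun i => if i ∈ A then grid (explore m t) t else {0}

lemma gridVectors_card (m t : ℕ) (A : Finset (Fin d)) :
    (gridVectors m t A).card = (grid (explore m t) t).card ^ A.card := by
  rw [gridVectors, Fintype.card_piFinset]
  simp only [apply_ite Finset.card, Finset.card_singleton]
  rw [Finset.prod_ite_mem, Finset.univ_inter, Finset.prod_const]

/-- An integrable majorant of the indicator of the event that the index of `A` at time `t` lies
below its true reward: a sum of exponential supermartingales over a finite grid of parameters. -/
def failWeight (m : ℕ) (Z : ℕ → Fin d → Ω → ℝ) (θ : Fin d → ℝ) (x : ℕ → Ω → Finset (Fin d))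
    (A : Finset (Fin d)) (t : ℕ) (ω : Ω) : ℝ :=
  if t < 3 then 1 else ∑ l ∈ gridVectors m t A,
    Real.exp (m - explore m t) * ∏ i ∈ A, expDev Z θ x (-l i) t i ω

lemma failWeight_nonneg (m : ℕ) (A : Finset (Fin d)) (t : ℕ) (ω : Ω) :
    0 ≤ failWeight m Z θ x A t ω := by
  unfold failWeight
  split_ifs
  · exact zero_le_one
  · exact Finset.sum_nonneg fun l _ => mul_nonneg (Real.exp_pos _).le
      (Finset.prod_nonneg fun i _ => expDev_nonneg _ _ _ _)

/-- By the Cauchy-Schwarz inequality, an index below the true reward forces the Chernoff exponents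
of the entries of `A` to add up to more than `explore m t`, even after each of them is capped at
that level; the parameters of the grid nearly achieve these exponents. -/
lemma one_le_failWeight {m t : ℕ} (ht : 1 ≤ t) {A : Finset (Fin d)} (hA : A.card ≤ m) {ω : Ω}
    (hobs : ∀ i ∈ A, 1 ≤ count x t i ω)
    (h : ∑ i ∈ A, empMean Z x t i ω + √(width m x t ω A) < reward θ A) :
    1 ≤ failWeight m Z θ x A t ω := by
  unfold failWeight
  split_ifs with ht3
  · exact le_rfl
  push Not at ht3
  set f := explore m t with hf
  have hf1 : 1 ≤ f := one_le_explore m ht3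
  set n : Fin d → ℝ := fun i => count x t i ω with hn
  have hn1 : ∀ i ∈ A, 1 ≤ n i := fun i hi => by simpa [hn] using hobs i hi
  have hn0 : ∀ i, 0 ≤ n i := fun i => Nat.cast_nonneg _
  set y : Fin d → ℝ := fun i => -devSum Z θ x t i ω with hy
  set L : Fin d → ℝ := fun i => 2 * max (y i) 0 ^ 2 / n i with hL
  have hL0 : ∀ i, 0 ≤ L i := fun i => by have := hn0 i; positivity
  have h1 : √(width m x t ω A) < ∑ i ∈ A, max (y i) 0 / n i := by
    have h2 : ∑ i ∈ A, empMean Z x t i ω = reward θ A - ∑ i ∈ A, y i / n i := by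
      rw [reward, ← Finset.sum_sub_distrib]
      refine Finset.sum_congr rfl fun i hi => ?_
      rw [empMean_eq θ (hobs i hi)]; simp only [hy, hn]; ring
    have h3 : ∑ i ∈ A, y i / n i ≤ ∑ i ∈ A, max (y i) 0 / n i :=
      Finset.sum_le_sum fun i _ => div_le_div_of_nonneg_right (le_max_left _ _) (hn0 i)
    linarith
  have h4 : f < ∑ i ∈ A, L i := by
    have hcs : (∑ i ∈ A, max (y i) 0 / n i) ^ 2 ≤
        (∑ i ∈ A, L i) * ∑ i ∈ A, 1 / (2 * n i) := by
      refine Finset.sum_sq_le_sum_mul_sum_of_sq_le_mul A (fun i _ => hL0 i)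
        (fun i _ => by have := hn0 i; positivity) fun i hi => ?_
      have := hn1 i hi
      simp only [hL]
      refine le_of_eq ?_
      field_simp
    have hw : width m x t ω A = f * ∑ i ∈ A, 1 / (2 * n i) := by
      rw [width, Finset.mul_sum]
      exact Finset.sum_congr rfl fun i _ => by rw [mul_one_div]
    have h5 : width m x t ω A < (∑ i ∈ A, max (y i) 0 / n i) ^ 2 :=
      Real.lt_sq_of_sqrt_lt h1
    rw [hw] at h5
    exact lt_of_mul_lt_mul_right (h5.trans_le hcs)
      (Finset.sum_nonneg fun i _ => by have := hn0 i; positivity)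
  have h6 : f ≤ ∑ i ∈ A, min (L i) f := by
    by_cases hcap : ∃ i ∈ A, f < L i
    · obtain ⟨i, hi, hfi⟩ := hcap
      calc f = min (L i) f := (min_eq_right hfi.le).symm
        _ ≤ _ := Finset.single_le_sum (f := fun i => min (L i) f)
          (fun j _ => le_min (hL0 j) (by linarith)) hi
    · push Not at hcap
      rw [Finset.sum_congr rfl fun i hi => min_eq_left (hcap i hi)]
      exact h4.le
  have h7 : ∀ i, ∃ l ∈ (if i ∈ A then grid f t else {0}), i ∈ A →
      min (L i) f - 1 ≤ l * y i - n i * (l ^ 2 / 8) := by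
    intro i
    by_cases hi : i ∈ A
    · obtain ⟨l, hl, hle⟩ := exists_mem_grid hf1 (hobs i hi) (count_lt ht i ω).le (y i)
      exact ⟨l, by simpa [hi] using hl, fun _ => hle⟩
    · exact ⟨0, by simp [hi], fun h => absurd h hi⟩
  choose l hl hle using h7
  have hmem : l ∈ gridVectors m t A := Fintype.mem_piFinset.2 hl
  refine le_trans ?_ (Finset.single_le_sum
    (f := fun l : Fin d → ℝ => Real.exp (m - f) * ∏ i ∈ A, expDev Z θ x (-l i) t i ω)
    (fun l _ => mul_nonneg (Real.exp_pos _).le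
      (Finset.prod_nonneg fun i _ => expDev_nonneg _ _ _ _)) hmem)
  simp only [expDev]
  rw [← Real.exp_sum, ← Real.exp_add, Real.one_le_exp_iff]
  have h8 : ∑ i ∈ A, (min (L i) f - 1) ≤
      ∑ i ∈ A, (-l i * devSum Z θ x t i ω - count x t i ω * ((-l i) ^ 2 / 8)) := by
    refine Finset.sum_le_sum fun i hi => (hle i hi).trans (le_of_eq ?_)
    simp only [hy, hn]; ring
  rw [Finset.sum_sub_distrib, Finset.sum_const, nsmul_eq_mul, mul_one] at h8
  have h9 : (A.card : ℝ) ≤ m := by exact_mod_cast hA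
  linarith

lemma integral_failWeight_le [MeasurableSpace Ω] {μ : Measure Ω} [IsProbabilityMeasure μ]
    (hZ : IsEnvironment μ θ Z) (hx : IsPolicy X Z x) {m t : ℕ} (hm : 1 ≤ m) (ht : 1 ≤ t)
    {A : Finset (Fin d)} (hA : A.card ≤ m) :
    Integrable (failWeight m Z θ x A t) μ ∧ ∫ ω, failWeight m Z θ x A t ω ∂μ ≤
      if t < 3 then 1 else failConst m * (1 / (t * Real.log t ^ 2)) := by
  by_cases ht3 : t < 3
  · have : failWeight m Z θ x A t = fun _ => 1 := by ext; simp [failWeight, ht3]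
    rw [this]
    simp [ht3]
  · have : failWeight m Z θ x A t = fun ω => ∑ l ∈ gridVectors m t A,
        Real.exp (m - explore m t) * ∏ i ∈ A, expDev Z θ x (-l i) t i ω := by
      ext; simp [failWeight, ht3]
    have hint := fun l : Fin d → ℝ =>
      integral_prod_expDev_le_one hZ hx A (fun i => -l i) ht
    rw [this, if_neg ht3]
    refine ⟨integrable_finsetSum _ fun l _ => (hint l).1.const_mul _, ?_⟩
    rw [integral_finsetSum _ fun l _ => (hint l).1.const_mul _]
    calc _ ≤ ∑ l ∈ gridVectors m t A, Real.exp (m - explore m t) := by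
          refine Finset.sum_le_sum fun l _ => ?_
          rw [integral_const_mul]
          exact mul_le_of_le_one_right (Real.exp_pos _).le (hint l).2
      _ = ((grid (explore m t) t).card : ℝ) ^ A.card * Real.exp (m - explore m t) := by
          rw [Finset.sum_const, gridVectors_card, nsmul_eq_mul]; push_cast; rfl
      _ ≤ _ := grid_card_pow_mul_exp_le hm (by omega) hA

/-- The regret of one round in which optimism does not fail: it is at most the slack `δ` plus the
overestimation of the decision played plus its exploration bonus. -/
lemma IsAESCB.gap_le (hx : IsAESCB X Z ε δ x) {t : ℕ} (ht : 1 ≤ t) (hε : 0 < ε t) {ω : Ω}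
    (hobs : ∀ i ∈ x t ω, 1 ≤ count x t i ω) {B : Finset (Fin d)} (hB : B ∈ X)
    (hopt : reward θ B = optReward X θ) (hfail : failWeight (maxSize X) Z θ x B t ω < 1) :
    gap X θ (x t ω) ≤ δ t + ∑ i ∈ x t ω, devSum Z θ x t i ω / count x t i ω +
      1 / ε t * √(width (maxSize X) x t ω (x t ω)) := by
  obtain ⟨hobsB, hle⟩ := hx.index_le ht hε hobs hB
  have h1 : reward θ B ≤ ∑ i ∈ B, empMean Z x t i ω + √(width (maxSize X) x t ω B) := by
    by_contra hcon
    exact absurd (one_le_failWeight ht (card_le_maxSize hB) hobsB (not_le.1 hcon)) (not_le.2 hfail)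
  have h2 : ∑ i ∈ x t ω, empMean Z x t i ω =
      reward θ (x t ω) + ∑ i ∈ x t ω, devSum Z θ x t i ω / count x t i ω := by
    rw [reward, ← Finset.sum_add_distrib]
    exact Finset.sum_congr rfl fun i hi => empMean_eq θ (hobs i hi)
  rw [gap, ← hopt]
  linarith

end Index

section Rounds

variable {d : ℕ} {Ω : Type*} {X : Finset (Finset (Fin d))} {θ : Fin d → ℝ}
  {Z : ℕ → Fin d → Ω → ℝ} {x : ℕ → Ω → Finset (Fin d)} {ε δ : ℕ → ℝ}

/-! ### The regret of a single round -/

/-- The charge of one round for the additive slack `δ`. -/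
def slackCharge (X : Finset (Finset (Fin d))) (θ : Fin d → ℝ) (δ : ℕ → ℝ) (t : ℕ) : ℝ :=
  4 * (δ t * if minGap X θ ≤ 4 * δ t then 1 else 0)

lemma slackCharge_nonneg (hD : 0 < minGap X θ) (t : ℕ) : 0 ≤ slackCharge X θ δ t := by
  unfold slackCharge
  split_ifs with h
  · linarith
  · simp

lemma slackCharge_eq {t : ℕ} (h : minGap X θ ≤ 4 * δ t) : slackCharge X θ δ t = 4 * δ t := by
  rw [slackCharge, if_pos h, mul_one]

/-- A deviation `D ≥ v` after `p²` observations is dominated by the normalized exponential with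
parameter `1 / p`, up to a factor that is summable over the number of observations. -/
lemma dev_le_mul_exp {p v D : ℝ} (hp : 0 < p) (hv : 0 < v) (hD : v ≤ D) :
    D ≤ 22 / (p * (1 + v * p) ^ 2) * Real.exp (p * D - 1 / 8) := by
  have hz : 0 < p * D := mul_pos hp (hv.trans_le hD)
  set z := p * D with hzdef
  have h1 : z ≤ Real.exp z := by have := Real.add_one_le_exp z; linarith
  have h2 : z ^ 2 / 2 ≤ Real.exp z := by
    simpa using Real.pow_div_factorial_le_exp z hz.le 2
  have h3 : z ^ 3 / 6 ≤ Real.exp z := by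
    simpa [Nat.factorial] using Real.pow_div_factorial_le_exp z hz.le 3
  have h4 : 7 / 8 * Real.exp z ≤ Real.exp (z - 1 / 8) := by
    rw [sub_eq_add_neg, Real.exp_add, mul_comm]
    gcongr
    have := Real.add_one_le_exp (-(1 / 8 : ℝ)); linarith
  have h5 : z * (1 + v * p) ^ 2 ≤ z * (1 + z) ^ 2 := by
    have : v * p ≤ z := by rw [hzdef, mul_comm]; gcongr
    gcongr
  have h6 : z * (1 + z) ^ 2 ≤ 22 * Real.exp (z - 1 / 8) := by
    have : z * (1 + z) ^ 2 = z + 2 * z ^ 2 + z ^ 3 := by ring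
    have := Real.exp_pos z
    linarith
  rw [div_mul_eq_mul_div, le_div_iff₀ (by positivity)]
  calc D * (p * (1 + v * p) ^ 2) = z * (1 + v * p) ^ 2 := by rw [hzdef]; ring
    _ ≤ _ := h5.trans h6

/-- Pigeonhole: a sum of at most `m` terms above `g` has a term at least `g / m`. -/
lemma exists_dev_ge {A : Finset (Fin d)} {m : ℕ} (hm : 1 ≤ m) (hA : A.card ≤ m) {g : ℝ}
    (hg : 0 ≤ g) {w : Fin d → ℝ} (h : g < ∑ i ∈ A, w i) : ∃ i ∈ A, g / m ≤ w i := by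
  by_contra hcon
  push Not at hcon
  have hm0 : (0 : ℝ) < m := by exact_mod_cast hm
  have : ∑ i ∈ A, w i ≤ g := by
    calc ∑ i ∈ A, w i ≤ ∑ i ∈ A, g / m := Finset.sum_le_sum fun i hi => (hcon i hi).le
      _ = A.card * (g / m) := by rw [Finset.sum_const, nsmul_eq_mul]
      _ ≤ m * (g / m) := by gcongr
      _ = g := by field_simp
  linarith

/-- The regret of a round, in the regime where the exploration term of the bound dominates. The
gap is charged to a failure of optimism, to the slack, to an unobserved entry, to an entry that is
overestimated by a fraction of the gap, or else to the exploration bonus. -/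
lemma IsAESCB.gap_le_of_explore (hx : IsAESCB X Z ε δ x) (hθ : ∀ i, θ i ∈ Set.Icc (0 : ℝ) 1)
    (hm : 2 ≤ maxSize X) (hX : ∃ A ∈ X, 0 < gap X θ A) {B : Finset (Fin d)} (hB : B ∈ X)
    (hopt : reward θ B = optReward X θ) {t T : ℕ} (ht : 1 ≤ t) (htT : t ≤ T) {e : ℝ} (he : 0 < e)
    (heε : e ≤ ε t) (hf : 0 < explore (maxSize X) T) (ω : Ω) :
    gap X θ (x t ω) ≤ slackCharge X θ δ t + maxSize X * failWeight (maxSize X) Z θ x B t ω +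
      ∑ i ∈ x t ω, (((if count x t i ω = 0 then (maxSize X : ℝ) else 0) +
        share (minGap X θ) (√(2 * (2 * explore (maxSize X) T / e ^ 2)) / minGap X θ) (maxSize X)
          (count x t i ω)) +
        4 * maxSize X * 22 * (1 / (√(count x t i ω : ℝ) *
          (1 + minGap X θ / (4 * maxSize X) * √(count x t i ω : ℝ)) ^ 2)) *
          expDev Z θ x (1 / √(count x t i ω : ℝ)) t i ω) := by
  have hD := minGap_pos hX
  have hmem := hx.policy.mem t ht ω
  have hgm := gap_le_maxSize hθ hmem
  have hcard := card_le_maxSize hmem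
  set m := maxSize X with hmdef
  have hm0 : (2 : ℝ) ≤ m := by exact_mod_cast hm
  set D := minGap X θ with hDdef
  set a := 2 * explore m T / e ^ 2 with ha
  have ha0 : 0 < a := by positivity
  set g := gap X θ (x t ω) with hg
  have hq := slackCharge_nonneg (δ := δ) hD t
  have hfw := failWeight_nonneg (Z := Z) (θ := θ) (x := x) m B t ω
  set S1 : Fin d → ℝ := fun i => if count x t i ω = 0 then (m : ℝ) else 0 with hS1
  set S2 : Fin d → ℝ := fun i => share D (√(2 * a) / D) m (count x t i ω) with hS2
  set S3 : Fin d → ℝ := fun i => 4 * m * 22 * (1 / (√(count x t i ω : ℝ) *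
          (1 + D / (4 * m) * √(count x t i ω : ℝ)) ^ 2)) *
          expDev Z θ x (1 / √(count x t i ω : ℝ)) t i ω with hS3
  have h1 : ∀ i, 0 ≤ S1 i := fun i => by simp only [hS1]; split_ifs <;> positivity
  have h2 : ∀ i, 0 ≤ S2 i := fun i => share_nonneg hD.le (by positivity) _ _
  have h3 : ∀ i, 0 ≤ S3 i := fun i =>
    mul_nonneg (by positivity) (expDev_nonneg _ _ _ _)
  have hmfw : 0 ≤ m * failWeight m Z θ x B t ω := by positivity
  change g ≤ slackCharge X θ δ t + m * failWeight m Z θ x B t ω +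
    ∑ i ∈ x t ω, (S1 i + S2 i + S3 i)
  have hs0 : ∀ i, 0 ≤ S1 i + S2 i + S3 i := fun i => by linarith [h1 i, h2 i, h3 i]
  have hsum : 0 ≤ ∑ i ∈ x t ω, (S1 i + S2 i + S3 i) := Finset.sum_nonneg fun i _ => hs0 i
  have hsingle : ∀ i ∈ x t ω, S1 i + S2 i + S3 i ≤ ∑ i ∈ x t ω, (S1 i + S2 i + S3 i) :=
    fun i hi => Finset.single_le_sum (f := fun i => S1 i + S2 i + S3 i) (fun j _ => hs0 j) hi
  rcases le_or_gt g 0 with hg0 | hg0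
  · linarith
  have hDg : D ≤ g := minGap_le_gap hmem hg0
  by_cases hobs : ∀ i ∈ x t ω, 1 ≤ count x t i ω
  swap
  · push Not at hobs
    obtain ⟨i, hi, hc⟩ := hobs
    have hS : S1 i = m := by simp only [hS1]; rw [if_pos (by omega)]
    linarith [hsingle i hi, h2 i, h3 i]
  rcases le_or_gt 1 (failWeight m Z θ x B t ω) with hfail | hfail
  · have : (m : ℝ) * 1 ≤ m * failWeight m Z θ x B t ω := by gcongr
    linarith
  rcases le_or_gt g (4 * δ t) with hδ | hδ
  · rw [slackCharge_eq (hDg.trans hδ)]; linarith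
  have hεt := he.trans_le heε
  have hmain := hx.gap_le ht hεt hobs hB hopt hfail
  rw [← hg] at hmain
  rcases lt_or_ge (g / 4) (∑ i ∈ x t ω, devSum Z θ x t i ω / count x t i ω) with hdev | hdev
  -- some entry is overestimated by at least `g / (4 m)`
  · obtain ⟨i, hi, hle⟩ := exists_dev_ge (by omega) hcard (by positivity) hdev
    have hn : (0 : ℝ) < count x t i ω := by exact_mod_cast hobs i hi
    have hp : 0 < √(count x t i ω : ℝ) := Real.sqrt_pos.2 hn
    have hpp : √(count x t i ω : ℝ) * √(count x t i ω : ℝ) = count x t i ω :=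
      Real.mul_self_sqrt hn.le
    rw [div_div] at hle
    have hv : D / (4 * m) ≤ devSum Z θ x t i ω / count x t i ω := le_trans (by gcongr) hle
    have h4 := dev_le_mul_exp hp (by positivity) hv
    have h5 : g ≤ 4 * m * (devSum Z θ x t i ω / count x t i ω) := by
      rwa [div_le_iff₀' (by positivity)] at hle
    have h6 : √(count x t i ω : ℝ) * (devSum Z θ x t i ω / count x t i ω) - 1 / 8 =
        1 / √(count x t i ω : ℝ) * devSum Z θ x t i ω -
          count x t i ω * ((1 / √(count x t i ω : ℝ)) ^ 2 / 8) := by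
      set p := √(count x t i ω : ℝ)
      rw [← hpp]; field_simp
    have h7 : g ≤ S3 i := by
      simp only [hS3, expDev]
      rw [h6] at h4
      calc g ≤ 4 * m * (devSum Z θ x t i ω / count x t i ω) := h5
        _ ≤ _ := mul_le_mul_of_nonneg_left h4 (by positivity)
        _ = _ := by ring
    linarith [hsingle i hi, h1 i, h2 i]
  -- slack and overestimation account for less than half of the gap; the bonus pays for the rest
  · have hw : g / 2 ≤ 1 / e * √(width m x t ω (x t ω)) := by
      have : 1 / ε t * √(width m x t ω (x t ω)) ≤ 1 / e * √(width m x t ω (x t ω)) := by gcongr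
      linarith
    have hsq : g ^ 2 ≤ a * ∑ i ∈ x t ω, 1 / (count x t i ω : ℝ) := by
      have h4 : (g / 2) ^ 2 ≤ (1 / e * √(width m x t ω (x t ω))) ^ 2 := by gcongr
      rw [mul_pow, Real.sq_sqrt (width_nonneg _ _ _ _ _)] at h4
      have h5 : width m x t ω (x t ω) ≤ explore m T / 2 * ∑ i ∈ x t ω, 1 / (count x t i ω : ℝ) := by
        rw [width, Finset.mul_sum]
        refine Finset.sum_le_sum fun i hi => ?_
        rw [← div_div, div_eq_mul_one_div (explore m t / 2)]
        have := explore_mono m ht htT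
        gcongr
      calc g ^ 2 = 4 * (g / 2) ^ 2 := by ring
        _ ≤ 4 * ((1 / e) ^ 2 * (explore m T / 2 * ∑ i ∈ x t ω, 1 / (count x t i ω : ℝ))) := by
            gcongr; exact h4.trans (by gcongr)
        _ = _ := by rw [ha]; ring
    have h8 : g ≤ ∑ i ∈ x t ω, S2 i := le_sum_share hobs hm hcard hD hDg ha0 hsq
    have h9 : ∑ i ∈ x t ω, S2 i ≤ ∑ i ∈ x t ω, (S1 i + S2 i + S3 i) :=
      Finset.sum_le_sum fun i _ => by linarith [h1 i, h3 i]
    linarith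

/-- The regret of a round, in the regime `2 ≤ ε_t`. Comparing the decision played with itself
bounds its exploration bonus by `2 δ_t`; a slack too small to pay for the round thus forces at least
three observations of each of its entries, and the overestimation of one of them. -/
lemma IsAESCB.gap_le_of_two_le (hx : IsAESCB X Z ε δ x) (hθ : ∀ i, θ i ∈ Set.Icc (0 : ℝ) 1)
    (hm : 2 ≤ maxSize X) (hX : ∃ A ∈ X, 0 < gap X θ A) {B : Finset (Fin d)} (hB : B ∈ X)
    (hopt : reward θ B = optReward X θ) {t : ℕ} (ht : 1 ≤ t) (hε : 2 ≤ ε t) (ω : Ω) :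
    gap X θ (x t ω) ≤ (slackCharge X θ δ t +
        (if (t : ℝ) < Real.exp (2 * (maxSize X : ℝ) ^ 2) then (maxSize X : ℝ) else 0)) +
      maxSize X * failWeight (maxSize X) Z θ x B t ω +
      ∑ i ∈ x t ω, ((if count x t i ω = 0 then (maxSize X : ℝ) else 0) +
        maxSize X * (if 3 ≤ count x t i ω then
          Real.exp (-((minGap X θ) ^ 2 / (2 * (maxSize X : ℝ) ^ 2) * count x t i ω)) else 0) *
          expDev Z θ x (2 * minGap X θ / maxSize X) t i ω) := by
  have hD := minGap_pos hX
  have hmem := hx.policy.mem t ht ω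
  have hgm := gap_le_maxSize hθ hmem
  have hcard := card_le_maxSize hmem
  set m := maxSize X with hmdef
  have hm0 : (2 : ℝ) ≤ m := by exact_mod_cast hm
  set D := minGap X θ with hDdef
  set g := gap X θ (x t ω) with hg
  have hq := slackCharge_nonneg (δ := δ) hD t
  have hfw := failWeight_nonneg (Z := Z) (θ := θ) (x := x) m B t ω
  set Q : ℝ := if (t : ℝ) < Real.exp (2 * (m : ℝ) ^ 2) then (m : ℝ) else 0 with hQ
  have hQ0 : 0 ≤ Q := by rw [hQ]; split_ifs <;> positivity
  set S1 : Fin d → ℝ := fun i => if count x t i ω = 0 then (m : ℝ) else 0 with hS1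
  set S3 : Fin d → ℝ := fun i => m * (if 3 ≤ count x t i ω then
          Real.exp (-(D ^ 2 / (2 * (m : ℝ) ^ 2) * count x t i ω)) else 0) *
          expDev Z θ x (2 * D / m) t i ω with hS3
  have h1 : ∀ i, 0 ≤ S1 i := fun i => by simp only [hS1]; split_ifs <;> positivity
  have h3 : ∀ i, 0 ≤ S3 i := fun i =>
    mul_nonneg (by split_ifs <;> positivity) (expDev_nonneg _ _ _ _)
  have hmfw : 0 ≤ m * failWeight m Z θ x B t ω := by positivity
  change g ≤ (slackCharge X θ δ t + Q) + m * failWeight m Z θ x B t ω +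
    ∑ i ∈ x t ω, (S1 i + S3 i)
  have hs0 : ∀ i, 0 ≤ S1 i + S3 i := fun i => by linarith [h1 i, h3 i]
  have hsum : 0 ≤ ∑ i ∈ x t ω, (S1 i + S3 i) := Finset.sum_nonneg fun i _ => hs0 i
  have hsingle : ∀ i ∈ x t ω, S1 i + S3 i ≤ ∑ i ∈ x t ω, (S1 i + S3 i) :=
    fun i hi => Finset.single_le_sum (f := fun i => S1 i + S3 i) (fun j _ => hs0 j) hi
  rcases le_or_gt g 0 with hg0 | hg0
  · linarith
  have hDg : D ≤ g := minGap_le_gap hmem hg0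
  rcases lt_or_ge (t : ℝ) (Real.exp (2 * (m : ℝ) ^ 2)) with hlt | hge
  · have : Q = m := by rw [hQ, if_pos hlt]
    linarith
  by_cases hobs : ∀ i ∈ x t ω, 1 ≤ count x t i ω
  swap
  · push Not at hobs
    obtain ⟨i, hi, hc⟩ := hobs
    have hS : S1 i = m := by simp only [hS1]; rw [if_pos (by omega)]
    linarith [hsingle i hi, h3 i]
  rcases le_or_gt 1 (failWeight m Z θ x B t ω) with hfail | hfail
  · have : (m : ℝ) * 1 ≤ m * failWeight m Z θ x B t ω := by gcongr
    linarith
  rcases le_or_gt g (4 * δ t) with hδ | hδ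
  · rw [slackCharge_eq (hDg.trans hδ)]; linarith
  have hεt : 0 < ε t := by linarith
  have hmain := hx.gap_le ht hεt hobs hB hopt hfail
  rw [← hg] at hmain
  -- the decision played, with factor `1`, competes against itself with factor `1 / ε_t ≤ 1 / 2`
  have hself := (hx.index_le ht hεt hobs hmem).2
  rw [← hmdef] at hmain hself
  have hs := Real.sqrt_nonneg (width m x t ω (x t ω))
  have hsε : 1 / ε t * √(width m x t ω (x t ω)) ≤ 1 / 2 * √(width m x t ω (x t ω)) := by gcongr
  set s := √(width m x t ω (x t ω)) with hsdef
  have hs2 : s ≤ 2 * δ t := by linarith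
  obtain ⟨i, hi, hle⟩ := exists_dev_ge (g := g / 2) (m := m)
    (w := fun i => devSum Z θ x t i ω / count x t i ω) (by omega) hcard (by positivity)
    (by linarith)
  have hn : (0 : ℝ) < count x t i ω := by exact_mod_cast hobs i hi
  have hn3 : 3 ≤ count x t i ω := by
    have hf : 2 * (m : ℝ) ^ 2 ≤ explore m t := by
      refine le_trans ?_ (log_le_explore m t)
      rwa [Real.le_log_iff_exp_le (by positivity)]
    have h4 : explore m t / (2 * count x t i ω) ≤ s ^ 2 := by
      rw [hsdef, Real.sq_sqrt (width_nonneg _ _ _ _ _)]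
      exact Finset.single_le_sum (f := fun i => explore m t / (2 * (count x t i ω : ℝ)))
        (fun j _ => by have := explore_nonneg m t; positivity) hi
    have h5 : s ^ 2 ≤ (m / 2 : ℝ) ^ 2 := by
      have : s ≤ m / 2 := by linarith
      gcongr
    have h6 : explore m t ≤ (m / 2 : ℝ) ^ 2 * (2 * count x t i ω) := by
      rw [← div_le_iff₀ (by positivity)]; linarith
    have h7 : (3 : ℝ) < count x t i ω := by
      by_contra hcon
      push Not at hcon
      nlinarith [sq_pos_of_pos (show (0 : ℝ) < m by linarith)]
    exact_mod_cast h7.le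
  have hv : D / (2 * m) ≤ devSum Z θ x t i ω / count x t i ω := by
    refine le_trans ?_ hle
    rw [div_div]; gcongr
  have hS : (m : ℝ) ≤ S3 i := by
    simp only [hS3, if_pos hn3, expDev]
    rw [mul_assoc, ← Real.exp_add]
    refine le_mul_of_one_le_right (by positivity) (Real.one_le_exp ?_)
    rw [le_div_iff₀ hn] at hv
    have h8 : 2 * D / m * (D / (2 * m) * count x t i ω) ≤ 2 * D / m * devSum Z θ x t i ω := by
      gcongr
    have h9 : 2 * D / m * (D / (2 * m) * count x t i ω) =
        D ^ 2 / (2 * (m : ℝ) ^ 2) * count x t i ω +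
          count x t i ω * ((2 * D / m) ^ 2 / 8) := by
      field_simp; ring
    linarith
  linarith [hsingle i hi, h1 i]

end Rounds

/-! ### Summation over the rounds -/

section Regret

variable {d : ℕ} {Ω : Type*} [MeasurableSpace Ω] {μ : Measure Ω} [IsProbabilityMeasure μ]
  {X : Finset (Finset (Fin d))} {θ : Fin d → ℝ}
  {Z : ℕ → Fin d → Ω → ℝ} {x : ℕ → Ω → Finset (Fin d)} {ε δ : ℕ → ℝ}

lemma sum_failure_le {m : ℕ} (T : ℕ) :
    ∑ t ∈ Finset.Icc 1 T, (if t < 3 then 1 else failConst m * (1 / (t * Real.log t ^ 2))) ≤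
      2 + 2 * failConst m := by
  rw [Finset.sum_ite]
  have h1 : ∑ t ∈ Finset.Icc 1 T with t < 3, (1 : ℝ) ≤ 2 := by
    have : (Finset.Icc 1 T).filter (· < 3) ⊆ Finset.Icc 1 2 := fun t ht => by
      simp only [Finset.mem_filter, Finset.mem_Icc] at ht ⊢; omega
    have := Finset.card_le_card this
    simp only [Nat.card_Icc] at this
    simpa using this
  have h2 : ∑ t ∈ Finset.Icc 1 T with ¬ t < 3, failConst m * (1 / ((t : ℝ) * Real.log t ^ 2)) ≤
      failConst m * 2 := by
    rw [← Finset.mul_sum]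
    refine mul_le_mul_of_nonneg_left (le_trans ?_ (sum_one_div_mul_log_sq_le T))
      (failConst_pos m).le
    refine Finset.sum_le_sum_of_subset_of_nonneg (fun t ht => ?_) fun t _ _ => by positivity
    simp only [Finset.mem_filter, Finset.mem_Icc] at ht ⊢; omega
  linarith

lemma integrable_gap (hZ : IsEnvironment μ θ Z) (hx : IsPolicy X Z x) {t : ℕ} (ht : 1 ≤ t) :
    Integrable (fun ω => gap X θ (x t ω)) μ := by
  have hθ := hZ.mean_mem_Icc
  refine Integrable.of_mem_Icc 0 (maxSize X) (Measurable.aemeasurable ?_) (ae_of_all _ fun ω =>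
    ⟨gap_nonneg (hx.mem t ht ω), gap_le_maxSize hθ (hx.mem t ht ω)⟩)
  have : (fun ω => gap X θ (x t ω)) = fun ω => ∑ A, if x t ω = A then gap X θ A else 0 := by
    ext ω; simp
  rw [this]
  exact Finset.measurable_sum _ fun A _ => Measurable.ite
    (hZ.past_le t _ (hx.measurableSet_eq ht le_rfl A)) measurable_const measurable_const

lemma regret_le_mul (hZ : IsEnvironment μ θ Z) (hx : IsPolicy X Z x) (T : ℕ) :
    regret μ X θ x T ≤ maxSize X * T := by
  have : ∀ t ∈ Finset.Icc 1 T, ∫ ω, gap X θ (x t ω) ∂μ ≤ maxSize X := fun t ht => by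
    have ht := (Finset.mem_Icc.1 ht).1
    calc ∫ ω, gap X θ (x t ω) ∂μ ≤ ∫ _, (maxSize X : ℝ) ∂μ :=
          integral_mono (integrable_gap hZ hx ht) (integrable_const _)
            fun ω => gap_le_maxSize hZ.mean_mem_Icc (hx.mem t ht ω)
      _ = maxSize X := by simp
  calc regret μ X θ x T ≤ ∑ t ∈ Finset.Icc 1 T, (maxSize X : ℝ) := Finset.sum_le_sum this
    _ = maxSize X * T := by simp [mul_comm]

/-- From charges of single rounds to the regret. Deterministic charges `q` add up; failures of
optimism have a summable probability; charges to played entries are summed over the number of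
their past observations. -/
lemma regret_le_of_gap_le (hZ : IsEnvironment μ θ Z) (hx : IsPolicy X Z x) (hm : 1 ≤ maxSize X)
    {B : Finset (Fin d)} (hB : B ∈ X) {T : ℕ} {q : ℕ → ℝ} {g c l : ℕ → ℝ} (hg : ∀ n, 0 ≤ g n)
    (hc : ∀ n, 0 ≤ c n)
    (h : ∀ t ∈ Finset.Icc 1 T, ∀ ω, gap X θ (x t ω) ≤
      q t + maxSize X * failWeight (maxSize X) Z θ x B t ω + ∑ i ∈ x t ω,
        (g (count x t i ω) + c (count x t i ω) * expDev Z θ x (l (count x t i ω)) t i ω)) :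
    regret μ X θ x T ≤ ∑ t ∈ Finset.Icc 1 T, q t +
      maxSize X * (2 + 2 * failConst (maxSize X)) +
      d * (∑ n ∈ Finset.range T, g n + ∑ n ∈ Finset.range T, c n) := by
  set m := maxSize X with hmdef
  have hfw := fun t (ht : t ∈ Finset.Icc 1 T) => integral_failWeight_le hZ hx hm
    (Finset.mem_Icc.1 ht).1 (card_le_maxSize hB)
  have hG := fun i => integral_sum_level_le hZ hx i g (fun _ => 0) hg T
  have hE := fun i => integral_sum_level_le hZ hx i c l hc T
  set G : Fin d → Ω → ℝ := fun i ω => ∑ s ∈ Finset.Icc 1 T, if i ∈ x s ω then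
      g (count x s i ω) * expDev Z θ x 0 s i ω else 0 with hGdef
  set E : Fin d → Ω → ℝ := fun i ω => ∑ s ∈ Finset.Icc 1 T, if i ∈ x s ω then
      c (count x s i ω) * expDev Z θ x (l (count x s i ω)) s i ω else 0 with hEdef
  have hpath : ∀ ω, ∑ t ∈ Finset.Icc 1 T, gap X θ (x t ω) ≤
      ((∑ t ∈ Finset.Icc 1 T, q t) + ∑ t ∈ Finset.Icc 1 T, m * failWeight m Z θ x B t ω) +
        ∑ i, (G i ω + E i ω) := by
    intro ω
    refine (Finset.sum_le_sum fun t ht => h t ht ω).trans (le_of_eq ?_)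
    rw [Finset.sum_add_distrib, Finset.sum_add_distrib]
    congr 1
    simp only [hGdef, hEdef]
    simp_rw [← Finset.sum_add_distrib]
    rw [Finset.sum_comm]
    refine Finset.sum_congr rfl fun t _ => ?_
    rw [← Finset.univ_inter (x t ω), ← Finset.sum_ite_mem]
    refine Finset.sum_congr rfl fun i _ => ?_
    rw [Finset.univ_inter]
    split_ifs
    · simp [expDev]
    · simp
  have hint1 : Integrable (fun ω => ∑ t ∈ Finset.Icc 1 T, m * failWeight m Z θ x B t ω) μ :=
    integrable_finsetSum _ fun t ht => (hfw t ht).1.const_mul _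
  have hint2 : Integrable (fun ω => ∑ i, (G i ω + E i ω)) μ :=
    integrable_finsetSum _ fun i _ => (hG i).1.add (hE i).1
  have hint0 : Integrable (fun _ : Ω => ∑ t ∈ Finset.Icc 1 T, q t) μ := integrable_const _
  have hint01 : Integrable (fun ω => (∑ t ∈ Finset.Icc 1 T, q t) +
      ∑ t ∈ Finset.Icc 1 T, m * failWeight m Z θ x B t ω) μ := hint0.add hint1
  calc regret μ X θ x T = ∫ ω, ∑ t ∈ Finset.Icc 1 T, gap X θ (x t ω) ∂μ := by
        rw [regret, integral_finsetSum _ fun t ht =>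
          integrable_gap hZ hx (Finset.mem_Icc.1 ht).1]
    _ ≤ ∫ ω, ((∑ t ∈ Finset.Icc 1 T, q t) +
          ∑ t ∈ Finset.Icc 1 T, m * failWeight m Z θ x B t ω) + ∑ i, (G i ω + E i ω) ∂μ :=
        integral_mono (integrable_finsetSum _ fun t ht =>
          integrable_gap hZ hx (Finset.mem_Icc.1 ht).1) (hint01.add hint2) hpath
    _ = ∑ t ∈ Finset.Icc 1 T, q t + ∑ t ∈ Finset.Icc 1 T, m * ∫ ω, failWeight m Z θ x B t ω ∂μ +
          ∑ i, (∫ ω, G i ω ∂μ + ∫ ω, E i ω ∂μ) := by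
        rw [integral_add hint01 hint2, integral_add hint0 hint1,
          integral_finsetSum _ fun t ht => (hfw t ht).1.const_mul _,
          integral_finsetSum (f := fun i ω => G i ω + E i ω) _
            fun i _ => (hG i).1.add (hE i).1]
        simp only [integral_const, probReal_univ, one_smul, integral_const_mul]
        congr 1
        exact Finset.sum_congr rfl fun i _ => integral_add (hG i).1 (hE i).1
    _ ≤ ∑ t ∈ Finset.Icc 1 T, q t + m * (2 + 2 * failConst m) +
          ∑ i : Fin d, (∑ n ∈ Finset.range T, g n + ∑ n ∈ Finset.range T, c n) := by
        gcongr with i _ i _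
        · rw [← Finset.mul_sum]
          refine mul_le_mul_of_nonneg_left ?_ (by positivity)
          exact (Finset.sum_le_sum fun t ht => (hfw t ht).2).trans (sum_failure_le T)
        · exact (hG i).2
        · exact (hE i).2
    _ = _ := by rw [Finset.sum_const, Finset.card_univ, Fintype.card_fin, nsmul_eq_mul]

/-- The constant `C₄(m)`. The first term pays for failures of optimism. The two exponentials pay for
initial rounds: `ln t ≥ 2 m²` forces three observations when `ε_t ≥ 2`, and `2820 = 4 · 705`, where
`705 d m² / Δ_min` is the cost of unobserved and overestimated entries when `e < 2`, so `e² < 4`. -/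
def regretConst (m : ℕ) : ℝ :=
  m * (2 + 2 * failConst m) + m * Real.exp (2 * m ^ 2) + m * Real.exp (2820 * m ^ 2) + 1

lemma regretConst_pos (m : ℕ) : 0 < regretConst m := by
  have := failConst_pos m
  unfold regretConst; positivity

lemma one_le_ceil_log {m : ℕ} (hm : 2 ≤ m) : (1 : ℝ) ≤ (⌈Real.log m / 1.61⌉ : ℝ) := by
  have : 0 < Real.log m := Real.log_pos (by exact_mod_cast hm)
  exact_mod_cast Int.ceil_pos.2 (by positivity)

lemma one_add_log_le {m : ℕ} (hm : 2 ≤ m) :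
    1 + 16 * Real.log (1 + √(m : ℝ)) ≤ 24 * (⌈Real.log m / 1.61⌉ : ℝ) ^ 2 := by
  have hm0 : (2 : ℝ) ≤ m := by exact_mod_cast hm
  have h1 : Real.log (1 + √(m : ℝ)) ≤ (Real.log 3 + Real.log m) / 2 := by
    rw [← Real.log_mul (by norm_num) (by positivity), le_div_iff₀ (by norm_num), mul_comm]
    rw [show (2 : ℝ) * Real.log (1 + √(m : ℝ)) = ((2 : ℕ) : ℝ) * Real.log (1 + √(m : ℝ)) by
      push_cast; ring, ← Real.log_pow]
    refine Real.log_le_log (by positivity) ?_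
    have hs : √(m : ℝ) ^ 2 = m := Real.sq_sqrt (by positivity)
    have hs1 : 1.4 ≤ √(m : ℝ) := Real.le_sqrt_of_sq_le (by norm_num; linarith)
    nlinarith
  have h2 := Real.log_three_lt_d9
  have h3 : Real.log m ≤ 1.61 * (⌈Real.log m / 1.61⌉ : ℝ) := by
    have := Int.le_ceil (Real.log m / 1.61)
    rwa [div_le_iff₀' (by norm_num)] at this
  have h4 := one_le_ceil_log hm
  nlinarith

lemma minGap_le_maxSize (hθ : ∀ i, θ i ∈ Set.Icc (0 : ℝ) 1) (hX : ∃ A ∈ X, 0 < gap X θ A) :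
    minGap X θ ≤ maxSize X := by
  obtain ⟨A, hA, h⟩ := hX
  exact (minGap_le_gap hA h).trans (gap_le_maxSize hθ hA)

/-- The regime `2 ≤ e`. One unit for the round without observations, plus the geometric series from
`n = 3` on, is at most `1 / b = 2 m² / Δ_min²`, so that no exploration term is needed. -/
lemma regret_le_of_two_le (hZ : IsEnvironment μ θ Z) (hx : IsAESCB X Z ε δ x)
    (hm : 2 ≤ maxSize X) (hX : ∃ A ∈ X, 0 < gap X θ A) {T : ℕ} {e : ℝ} (he : 2 ≤ e)
    (heε : ∀ t ∈ Finset.Icc 1 T, e ≤ ε t) :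
    regret μ X θ x T ≤ mainBound (regretConst (maxSize X)) d (maxSize X) T (minGap X θ) e +
      ∑ t ∈ Finset.Icc 1 T, slackCharge X θ δ t := by
  have hθ := hZ.mean_mem_Icc
  obtain ⟨B, hB, hopt⟩ := exists_reward_eq_optReward (hX.imp fun _ h => h.1) θ
  have hD := minGap_pos hX
  have hDm := minGap_le_maxSize hθ hX
  set m := maxSize X with hmdef
  have hm0 : (2 : ℝ) ≤ m := by exact_mod_cast hm
  set D := minGap X θ with hDdef
  have h1 := regret_le_of_gap_le hZ hx.policy (by omega) hB (T := T)
    (q := fun t => slackCharge X θ δ t +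
        (if (t : ℝ) < Real.exp (2 * (m : ℝ) ^ 2) then (m : ℝ) else 0))
    (g := fun n => if n = 0 then (m : ℝ) else 0)
    (c := fun n => m * (if 3 ≤ n then Real.exp (-(D ^ 2 / (2 * (m : ℝ) ^ 2) * n)) else 0))
    (l := fun _ => 2 * D / m) (fun n => by positivity) (fun n => by positivity)
    (fun t ht ω => hx.gap_le_of_two_le hθ hm hX hB hopt (Finset.mem_Icc.1 ht).1
      (he.trans (heε t ht)) ω)
  rw [← hmdef, Finset.sum_add_distrib] at h1
  have hinit : ∑ t ∈ Finset.Icc 1 T, (if (t : ℝ) < Real.exp (2 * (m : ℝ) ^ 2) then (m : ℝ) else 0)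
      ≤ m * Real.exp (2 * (m : ℝ) ^ 2) := by
    rw [← Finset.sum_filter, Finset.sum_const, nsmul_eq_mul, mul_comm]
    refine mul_le_mul_of_nonneg_left ?_ (by positivity)
    have hsub : (Finset.Icc 1 T).filter (fun t : ℕ => (t : ℝ) < Real.exp (2 * (m : ℝ) ^ 2)) ⊆
        Finset.Icc 1 ⌊Real.exp (2 * (m : ℝ) ^ 2)⌋₊ := fun t ht => by
      simp only [Finset.mem_filter, Finset.mem_Icc] at ht ⊢
      exact ⟨ht.1.1, Nat.le_floor ht.2.le⟩
    have hcard := Finset.card_le_card hsub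
    rw [Nat.card_Icc, Nat.add_sub_cancel] at hcard
    exact (Nat.cast_le.2 hcard).trans (Nat.floor_le (Real.exp_pos _).le)
  have hlev : (∑ n ∈ Finset.range T, (if n = 0 then (m : ℝ) else 0)) + ∑ n ∈ Finset.range T,
      m * (if 3 ≤ n then Real.exp (-(D ^ 2 / (2 * (m : ℝ) ^ 2) * n)) else 0) ≤
      2 * m ^ 3 / D ^ 2 := by
    have hb : D ^ 2 / (2 * (m : ℝ) ^ 2) ≤ 1 / 2 := by
      rw [div_le_div_iff₀ (by positivity) (by norm_num)]
      have : D ^ 2 ≤ (m : ℝ) ^ 2 := by gcongr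
      linarith
    have h2 := one_add_sum_exp_le (b := D ^ 2 / (2 * (m : ℝ) ^ 2)) (by positivity) hb T
    have h3 : ∑ n ∈ Finset.range T, (if n = 0 then (m : ℝ) else 0) ≤ m := by
      rw [Finset.sum_ite_eq']; split_ifs <;> simp
    rw [← Finset.mul_sum]
    set E := ∑ n ∈ Finset.range T,
      (if 3 ≤ n then Real.exp (-(D ^ 2 / (2 * (m : ℝ) ^ 2) * n)) else 0)
    calc _ ≤ (m : ℝ) + m * E := by gcongr
      _ = m * (1 + E) := by ring
      _ ≤ m * (1 / (D ^ 2 / (2 * (m : ℝ) ^ 2))) := by gcongr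
      _ = _ := by field_simp
  have hlev' : (d : ℝ) * ((∑ n ∈ Finset.range T, (if n = 0 then (m : ℝ) else 0)) +
      ∑ n ∈ Finset.range T,
        m * (if 3 ≤ n then Real.exp (-(D ^ 2 / (2 * (m : ℝ) ^ 2) * n)) else 0)) ≤
      2 * d * m ^ 3 / D ^ 2 :=
    (mul_le_mul_of_nonneg_left hlev (by positivity)).trans (le_of_eq (by ring))
  have hthird : 0 ≤ 24 * d * explore m T / (e ^ 2 * D) * (⌈Real.log m / 1.61⌉ : ℝ) ^ 2 := by
    have := explore_nonneg m T
    positivity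
  have : (0 : ℝ) ≤ m * Real.exp (2820 * m ^ 2) := by positivity
  unfold mainBound regretConst
  linarith

/-- The regime `e < 2`. While `ln T` is below a multiple of `m²` the trivial bound `m T` suffices;
afterwards `f(T) / (e² Δ_min)` exceeds the cost of unobserved and overestimated entries. -/
lemma regret_le_of_lt_two (hZ : IsEnvironment μ θ Z) (hx : IsAESCB X Z ε δ x)
    (hm : 2 ≤ maxSize X) (hX : ∃ A ∈ X, 0 < gap X θ A) {T : ℕ} (hT : 1 ≤ T) {e : ℝ} (he : 0 < e)
    (he2 : e < 2) (heε : ∀ t ∈ Finset.Icc 1 T, e ≤ ε t) :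
    regret μ X θ x T ≤ mainBound (regretConst (maxSize X)) d (maxSize X) T (minGap X θ) e +
      ∑ t ∈ Finset.Icc 1 T, slackCharge X θ δ t := by
  have hθ := hZ.mean_mem_Icc
  obtain ⟨B, hB, hopt⟩ := exists_reward_eq_optReward (hX.imp fun _ h => h.1) θ
  have hD := minGap_pos hX
  have hDm := minGap_le_maxSize hθ hX
  have hslack : 0 ≤ ∑ t ∈ Finset.Icc 1 T, slackCharge X θ δ t :=
    Finset.sum_nonneg fun t _ => slackCharge_nonneg hD t
  have htriv := regret_le_mul (θ := θ) hZ hx.policy T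
  set m := maxSize X with hmdef
  have hm0 : (2 : ℝ) ≤ m := by exact_mod_cast hm
  set D := minGap X θ with hDdef
  have hfc := failConst_pos m
  have hfn := explore_nonneg m T
  have hT0 : (1 : ℝ) ≤ T := by exact_mod_cast hT
  have hsecond : 0 ≤ 2 * d * m ^ 3 / D ^ 2 := by positivity
  have hthird : 0 ≤ 24 * d * explore m T / (e ^ 2 * D) * (⌈Real.log m / 1.61⌉ : ℝ) ^ 2 := by
    positivity
  have hexp2 : (0 : ℝ) ≤ m * Real.exp (2 * m ^ 2) := by positivity
  have hexp3 : (0 : ℝ) ≤ m * Real.exp (2820 * m ^ 2) := by positivity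
  have hfc' : 0 ≤ m * (2 + 2 * failConst m) := by positivity
  rcases lt_or_ge (T : ℝ) (Real.exp (2820 * (m : ℝ) ^ 2)) with hlt | hge
  · have : (m : ℝ) * T ≤ m * Real.exp (2820 * m ^ 2) := by gcongr
    unfold mainBound regretConst
    linarith
  have hflog : 2820 * (m : ℝ) ^ 2 ≤ explore m T := by
    refine le_trans ?_ (log_le_explore m T)
    rwa [Real.le_log_iff_exp_le (by positivity)]
  have hf : 0 < explore m T := lt_of_lt_of_le (by positivity) hflog
  set r := √(2 * (2 * explore m T / e ^ 2)) / D with hr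
  have hr0 : 0 < r := by positivity
  set F := explore m T / (e ^ 2 * D) with hF
  have hF0 : 0 < F := by positivity
  have hrF : 4 * D * r ^ 2 = 16 * F := by
    rw [hr, div_pow, Real.sq_sqrt (by positivity), hF]; field_simp; ring
  have h1 := regret_le_of_gap_le hZ hx.policy (by omega) hB (T := T)
    (q := fun t => slackCharge X θ δ t)
    (g := fun n => (if n = 0 then (m : ℝ) else 0) + share D r m n)
    (c := fun n => 4 * m * 22 * (1 / (√(n : ℝ) * (1 + D / (4 * m) * √(n : ℝ)) ^ 2)))
    (l := fun n => 1 / √(n : ℝ))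
    (fun n => add_nonneg (by positivity) (share_nonneg hD.le hr0.le _ _))
    (fun n => by positivity)
    (fun t ht ω => hx.gap_le_of_explore hθ hm hX hB hopt (Finset.mem_Icc.1 ht).1
      (Finset.mem_Icc.1 ht).2 he (heε t ht) hf ω)
  rw [← hmdef, Finset.sum_add_distrib, ← Finset.mul_sum] at h1
  have h3 : ∑ n ∈ Finset.range T, (if n = 0 then (m : ℝ) else 0) ≤ m := by
    rw [Finset.sum_ite_eq']; split_ifs <;> simp
  have h4 := sum_share_le hD.le hr0 m T
  have h5 := sum_one_div_sqrt_mul_sq_le (v := D / (4 * m)) (by positivity) T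
  rw [hrF] at h4
  have h6 : 4 * m * 22 * (2 / (D / (4 * m))) = 704 * ((m : ℝ) ^ 2 / D) := by field_simp; ring
  have h7 : (m : ℝ) ≤ m ^ 2 / D := by rw [le_div_iff₀ hD, sq]; gcongr
  have h8 : 705 * ((m : ℝ) ^ 2 / D) ≤ F := by
    rw [hF, ← div_div, mul_div_assoc', div_le_div_iff_of_pos_right hD, le_div_iff₀ (by positivity)]
    have : e ^ 2 ≤ 4 := by nlinarith
    calc 705 * (m : ℝ) ^ 2 * e ^ 2 ≤ 705 * (m : ℝ) ^ 2 * 4 := by gcongr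
      _ ≤ explore m T := by linarith
  have h9 : 4 * m * 22 * ∑ n ∈ Finset.range T,
      1 / (√(n : ℝ) * (1 + D / (4 * m) * √(n : ℝ)) ^ 2) ≤ 704 * ((m : ℝ) ^ 2 / D) := by
    rw [← h6]; gcongr
  have h10 := one_add_log_le hm
  have h11 : F * (1 + 16 * Real.log (1 + √(m : ℝ))) ≤
      F * (24 * (⌈Real.log m / 1.61⌉ : ℝ) ^ 2) := by gcongr
  have h12 : (d : ℝ) * ((∑ n ∈ Finset.range T, if n = 0 then (m : ℝ) else 0) +
      ∑ n ∈ Finset.range T, share D r m n + 4 * m * 22 * ∑ n ∈ Finset.range T,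
      1 / (√(n : ℝ) * (1 + D / (4 * m) * √(n : ℝ)) ^ 2)) ≤
      d * (F * (24 * (⌈Real.log m / 1.61⌉ : ℝ) ^ 2)) := by
    refine mul_le_mul_of_nonneg_left ?_ (by positivity)
    linarith
  have h13 : 24 * d * explore m T / (e ^ 2 * D) * (⌈Real.log m / 1.61⌉ : ℝ) ^ 2 =
      d * (F * (24 * (⌈Real.log m / 1.61⌉ : ℝ) ^ 2)) := by rw [hF]; ring
  unfold mainBound regretConst
  linarith

theorem regret_le_mainBound (hZ : IsEnvironment μ θ Z) (hx : IsAESCB X Z ε δ x)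
    (hm : 2 ≤ maxSize X) (hX : ∃ A ∈ X, 0 < gap X θ A) (hε : ∀ t, 1 ≤ t → 0 < ε t) {T : ℕ}
    (hT : 1 ≤ T) :
    regret μ X θ x T ≤ mainBound (regretConst (maxSize X)) d (maxSize X) T (minGap X θ)
        (sInf (ε '' Set.Icc 1 T)) +
      4 * ∑ t ∈ Finset.Icc 1 T, δ t * (if minGap X θ ≤ 4 * δ t then 1 else 0) := by
  have hfin : (ε '' Set.Icc 1 T).Finite := (Set.finite_Icc 1 T).image _
  have hne : (ε '' Set.Icc 1 T).Nonempty := ⟨_, 1, ⟨le_rfl, hT⟩, rfl⟩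
  have he : 0 < sInf (ε '' Set.Icc 1 T) := by
    obtain ⟨t, ht, h⟩ := hne.csInf_mem hfin
    rw [← h]; exact hε t ht.1
  have heε : ∀ t ∈ Finset.Icc 1 T, sInf (ε '' Set.Icc 1 T) ≤ ε t := fun t ht =>
    csInf_le hfin.bddBelow ⟨t, Finset.mem_Icc.1 ht, rfl⟩
  rw [Finset.mul_sum]
  rcases lt_or_ge (sInf (ε '' Set.Icc 1 T)) 2 with h | h
  · exact regret_le_of_lt_two hZ hx hm hX hT he h heε
  · exact regret_le_of_two_le hZ hx hm hX h heε

lemma sInf_image_of_eq {e : ℝ} (hε : ∀ t, 1 ≤ t → ε t = e) {T : ℕ} (hT : 1 ≤ T) :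
    sInf (ε '' Set.Icc 1 T) = e := by
  have : ε '' Set.Icc 1 T = {e} := by
    ext y
    constructor
    · rintro ⟨t, ht, rfl⟩; exact hε t ht.1
    · rintro rfl; exact ⟨1, ⟨le_rfl, hT⟩, hε 1 le_rfl⟩
  rw [this, csInf_singleton]

/-! ### Asymptotics -/

lemma eventually_explore_le (m : ℕ) : ∀ᶠ T : ℕ in atTop, explore m T ≤ 2 * Real.log T := by
  have hlog : Tendsto (fun T : ℕ => Real.log T) atTop atTop :=
    Real.tendsto_log_atTop.comp tendsto_natCast_atTop_atTop
  have h := (Real.isLittleO_log_id_atTop.comp_tendsto hlog).def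
    (c := 1 / (4 * m + 1)) (by positivity)
  filter_upwards [h, hlog.eventually_ge_atTop 0] with T hT h0
  simp only [Function.comp, id, Real.norm_eq_abs, abs_of_nonneg h0] at hT
  have h1 : max (Real.log (Real.log T)) 0 ≤ 1 / (4 * m + 1) * Real.log T :=
    max_le ((le_abs_self _).trans hT) (by positivity)
  have h2 : 4 * (m : ℝ) * max (Real.log (Real.log T)) 0 ≤ Real.log T := by
    calc 4 * (m : ℝ) * max (Real.log (Real.log T)) 0
        ≤ 4 * m * (1 / (4 * m + 1) * Real.log T) := by gcongr
      _ = (4 * m / (4 * m + 1)) * Real.log T := by ring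
      _ ≤ 1 * Real.log T := by
          gcongr
          rw [div_le_one (by positivity)]; linarith
      _ = Real.log T := one_mul _
  unfold explore
  linarith

lemma sum_slack_le_of_tendsto (hδ : Tendsto δ atTop (𝓝 0)) {D : ℝ} (hD : 0 < D) :
    ∃ M : ℝ, ∀ T : ℕ, ∑ t ∈ Finset.Icc 1 T, δ t * (if D ≤ 4 * δ t then 1 else 0) ≤ M := by
  obtain ⟨N, hN⟩ := eventually_atTop.1 (hδ.eventually (gt_mem_nhds (show 0 < D / 4 by positivity)))
  set h : ℕ → ℝ := fun t => δ t * (if D ≤ 4 * δ t then 1 else 0) with hh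
  have h0 : ∀ t, 0 ≤ h t := fun t => by
    simp only [hh]
    split_ifs with h1
    · linarith
    · simp
  refine ⟨∑ t ∈ Finset.range N, h t, fun T => ?_⟩
  rw [← Finset.sum_filter_of_ne (p := fun t => t < N) (fun t _ ht => ?_)]
  · exact Finset.sum_le_sum_of_subset_of_nonneg
      (fun t ht => Finset.mem_range.2 (Finset.mem_filter.1 ht).2) fun t _ _ => h0 t
  · by_contra hcon
    have := hN t (not_lt.1 hcon)
    exact ht (by rw [if_neg (by linarith), mul_zero])

lemma ceil_log_le {m : ℕ} (hm : 2 ≤ m) : (⌈Real.log m / 1.61⌉ : ℝ) ≤ 3 * Real.log m := by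
  have h1 := (Int.ceil_lt_add_one (Real.log m / 1.61)).le
  have h2 : Real.log 2 ≤ Real.log m := Real.log_le_log (by norm_num) (by exact_mod_cast hm)
  have h3 := Real.log_two_gt_d9
  have h4 : Real.log m / 1.61 ≤ Real.log m / 1 := by
    gcongr; norm_num
  linarith

theorem eventually_regret_le (hZ : IsEnvironment μ θ Z) (hx : IsAESCB X Z ε δ x)
    (hm : 2 ≤ maxSize X) (hX : ∃ A ∈ X, 0 < gap X θ A) {e : ℝ} (he : 0 < e)
    (hε : ∀ t, 1 ≤ t → ε t = e) (hδ : Tendsto δ atTop (𝓝 0)) :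
    ∀ᶠ T : ℕ in atTop, regret μ X θ x T ≤
      (432 / e ^ 2 + 1) * (d * Real.log (maxSize X) ^ 2 * (1 / minGap X θ) * Real.log T) := by
  have hD := minGap_pos hX
  obtain ⟨M, hM⟩ := sum_slack_le_of_tendsto hδ hD
  have hd : 1 ≤ d := by
    by_contra hcon
    obtain rfl : d = 0 := by omega
    have : maxSize X ≤ 0 := Finset.sup_le fun A _ => by simp [Finset.eq_empty_of_isEmpty A]
    omega
  set m := maxSize X with hmdef
  set D := minGap X θ with hDdef
  have hd0 : (1 : ℝ) ≤ d := by exact_mod_cast hd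
  have hlm : 0 < Real.log m := Real.log_pos (by exact_mod_cast hm)
  have hlog : Tendsto (fun T : ℕ => Real.log T) atTop atTop :=
    Real.tendsto_log_atTop.comp tendsto_natCast_atTop_atTop
  have hcoef : 0 < d * Real.log m ^ 2 * (1 / D) := by positivity
  have hbig := (hlog.const_mul_atTop hcoef).eventually_ge_atTop
    (regretConst m + 2 * d * m ^ 3 / D ^ 2 + 4 * M)
  filter_upwards [hbig, eventually_explore_le m, eventually_ge_atTop 1] with T h1 h2 h3
  have h4 := regret_le_mainBound hZ hx hm hX (fun t ht => by rw [hε t ht]; exact he) h3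
  rw [sInf_image_of_eq hε h3, mainBound] at h4
  have h5 := hM T
  have h6 : (⌈Real.log m / 1.61⌉ : ℝ) ^ 2 ≤ (3 * Real.log m) ^ 2 := by
    have := one_le_ceil_log hm
    have := ceil_log_le hm
    gcongr
  have h7 : 24 * d * explore m T / (e ^ 2 * D) * (⌈Real.log m / 1.61⌉ : ℝ) ^ 2 ≤
      432 / e ^ 2 * (d * Real.log m ^ 2 * (1 / D) * Real.log T) := by
    have h8 : 0 ≤ Real.log T := Real.log_natCast_nonneg T
    calc _ ≤ 24 * d * (2 * Real.log T) / (e ^ 2 * D) * (3 * Real.log m) ^ 2 := by gcongr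
      _ = _ := by field_simp; ring
  rw [← hmdef, ← hDdef] at h4
  linarith

end Regret

end SemiBandit

end

theorem mainTheorem1 :
    -- the finite-time bounds, with one function `C = C₄` of `m` alone
    (∃ C : ℕ → ℝ, (∀ m, 0 < C m) ∧
      ∀ (d : ℕ) (X : Finset (Finset (Fin d))) (Ω : Type*) [MeasurableSpace Ω] (μ : Measure Ω)
        [IsProbabilityMeasure μ] (θ : Fin d → ℝ) (Z : ℕ → Fin d → Ω → ℝ) (ε δ : ℕ → ℝ)
        (x : ℕ → Ω → Finset (Fin d)),
        2 ≤ SemiBandit.maxSize X →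
        (∃ A ∈ X, 0 < SemiBandit.gap X θ A) →
        SemiBandit.IsEnvironment μ θ Z →
        (∀ t, 1 ≤ t → 0 < ε t) →
        SemiBandit.IsAESCB X Z ε δ x →
        (∀ T : ℕ, 1 ≤ T →
          SemiBandit.regret μ X θ x T ≤
            SemiBandit.mainBound (C (SemiBandit.maxSize X)) d (SemiBandit.maxSize X) T
                (SemiBandit.minGap X θ) (sInf (ε '' Set.Icc 1 T)) +
              4 * ∑ t ∈ Finset.Icc 1 T,
                δ t * (if SemiBandit.minGap X θ ≤ 4 * δ t then 1 else 0)) ∧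
        (∀ e : ℝ, (∀ t, 1 ≤ t → ε t = e) →
          (∀ t, 1 ≤ t → δ t < 1 / 4 * SemiBandit.minGap X θ) →
          ∀ T : ℕ, 1 ≤ T →
            SemiBandit.regret μ X θ x T ≤
              SemiBandit.mainBound (C (SemiBandit.maxSize X)) d (SemiBandit.maxSize X) T
                (SemiBandit.minGap X θ) e)) ∧
    -- the asymptotic bound, with an implied constant `K` that depends on `e` alone
    (∀ e : ℝ, 0 < e → ∃ K : ℝ, 0 < K ∧
      ∀ (d : ℕ) (X : Finset (Finset (Fin d))) (Ω : Type*) [MeasurableSpace Ω] (μ : Measure Ω)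
        [IsProbabilityMeasure μ] (θ : Fin d → ℝ) (Z : ℕ → Fin d → Ω → ℝ) (ε δ : ℕ → ℝ)
        (x : ℕ → Ω → Finset (Fin d)),
        2 ≤ SemiBandit.maxSize X →
        (∃ A ∈ X, 0 < SemiBandit.gap X θ A) →
        SemiBandit.IsEnvironment μ θ Z →
        (∀ t, 1 ≤ t → ε t = e) →
        Tendsto δ atTop (𝓝 0) →
        SemiBandit.IsAESCB X Z ε δ x →
        ∀ᶠ T : ℕ in atTop,
          SemiBandit.regret μ X θ x T ≤
            K * (d * Real.log (SemiBandit.maxSize X) ^ 2 * (1 / SemiBandit.minGap X θ) *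
              Real.log T)) := by
  refine ⟨⟨SemiBandit.regretConst, SemiBandit.regretConst_pos, ?_⟩, ?_⟩
  · intro d X Ω _ μ _ θ Z ε δ x hm hX hZ hε hx
    refine ⟨fun T hT => SemiBandit.regret_le_mainBound hZ hx hm hX hε hT, ?_⟩
    intro e he hδ T hT
    have h := SemiBandit.regret_le_mainBound hZ hx hm hX hε hT
    rw [SemiBandit.sInf_image_of_eq he hT] at h
    refine h.trans (le_of_eq ?_)
    rw [Finset.sum_eq_zero fun t ht => ?_, mul_zero, add_zero]
    rw [if_neg (by linarith [hδ t (Finset.mem_Icc.1 ht).1]), mul_zero]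
  · intro e he
    refine ⟨432 / e ^ 2 + 1, by positivity, ?_⟩
    intro d X Ω _ μ _ θ Z ε δ x hm hX hZ hε hδ hx
    exact SemiBandit.eventually_regret_le hZ hx hm hX he hε hδ
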